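/- Let $n\ge 1$ be an integer, $\nu=1/n$, and let $(\mathfrak H(t))_{t\ge 0}$ be a $\nu$-stable subordinator: a process with $\mathfrak H(0)=0$, independent and stationary increments, almost surely nondecreasing right-continuous paths, and $\mathbb E\,e^{-\lambda \mathfrak H(t)}=e^{-t\lambda^{\nu}}$ for $\lambda>0$, $t\ge 0$. Let $h_\nu(\cdot,t)$ denote the law of $\mathfrak H(t)$. For a nonnegative integer $k$ put $D^k_{0-,z}=(-1)^k\partial^k/\partial z^k$ (with $D_{0-,z}=D^1_{0-,z}$), and let $\Phi_\alpha(z)=z^{-\alpha}/\Gamma(1-\alpha)$ for $z>0$ and $\Phi_\alpha(z)=0$ for $z\le 0$. (a) For every $n\ge1$ the laws satisfy $$\left(D^n_{0-,t}+D_{0-,x}\right)h_\nu=0,\qquad x>0,\ t>0,$$ in the sense of distributions, that is, $\int_0^\infty\int \left(\partial_t^n\varphi(x,t)+\partial_x\varphi(x,t)\right)h_\nu(dx,t)\,dt=0$ for all $\varphi\in C_c^\infty((0,\infty)^2)$. They satisfy the initial condition $h_\nu(\cdot,0)=\delta$, in the sense that $\int f(x)\,h_\nu(dx,t)\to f(0)$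 as $t\to0^+$ for every bounded continuous $f:\mathbb R\to\mathbb R$, and the boundary condition $h_\nu(0,t)=0$, in the sense that $\varepsilon^{-1}\Pr\{\mathfrak H(t)\le\varepsilon\}\to0$ as $\varepsilon\to0^+$ for every $t>0$. (b) If $n\ge2$, then there is a function $h_\nu(x,t)\ge 0$ on $x>0$, $t>0$ such that, for every $t>0$, the law of $\mathfrak H(t)$ is $h_\nu(x,t)\,dx$ on $(0,\infty)$, and such that $h_\nu$ is $n$ times continuously differentiable in $t$ (for each $x>0$), differentiable in $x$ (for each $t>0$), and satisfies $$\left(D^n_{0-,t}+D_{0-,x}\right)h_\nu(x,t)=0\qquad\text{for all } x>0,\ t>0$$ in the classical sense; moreover $h_\nu(x,0^+)=0$ for all $x>0$, $h_\nu(0^+,t)=0$ for all $t>0$, and $$D^k_{0-,t}h_\nu(x,t)\Big|_{t=0^+}=\Phi_{k/n+1}(x),\qquad 0<k<n,\ x>0.$$ -/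

import Mathlib

open MeasureTheory ProbabilityTheory Filter Set
open scoped Topology NNReal ContDiff BoundedContinuousFunction

/-- `H` is a `ν`-stable subordinator on `(Ω, P)`: it starts at `0`, has independent and stationary
increments, its paths are almost surely nondecreasing and right-continuous, and
`E exp (-l H_t) = exp (-t l ^ ν)` for `l > 0`. -/
structure IsStableSubordinator {Ω : Type*} [MeasurableSpace Ω] (ν : ℝ) (H : ℝ≥0 → Ω → ℝ)
    (P : Measure Ω) : Prop where
  measurable : ∀ t, Measurable (H t)
  start : ∀ᵐ w ∂P, H 0 w = 0
  indep : HasIndepIncrements H P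
  stationary : ∀ s t, P.map (fun w => H (s + t) w - H s w) = P.map (H t)
  paths : ∀ᵐ w ∂P, Monotone (fun t => H t w) ∧
    ∀ t, ContinuousWithinAt (fun s => H s w) (Ici t) t
  laplace : ∀ (t : ℝ≥0) (l : ℝ), 0 < l →
    ∫ w, Real.exp (-l * H t w) ∂P = Real.exp (-(t : ℝ) * l ^ ν)

/-- The left-sided operator `D^k_{0-} = (-1)^k d^k/dz^k` of integer order `k`. -/
noncomputable def leftD (k : ℕ) (f : ℝ → ℝ) (z : ℝ) : ℝ :=
  (-1) ^ k * iteratedDeriv k f z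

/-- `Φ_α(z) = z_+^{-α} / Γ(1 - α)`. -/
noncomputable def Phi (α z : ℝ) : ℝ :=
  if 0 < z then z ^ (-α) / Real.Gamma (1 - α) else 0

/-- The family of measures `μ t (dx)`, `t > 0`, solves `(D^n_{0-,t} + D_{0-,x}) μ = 0` in the sense
of distributions on the quadrant `x > 0`, `t > 0`. The formal adjoint of `D^k_{0-}` is `d^k/dz^k`,
so no signs remain on the test function. -/
def SolvesDistributionally (n : ℕ) (μ : ℝ → Measure ℝ) : Prop :=
  ∀ φ : ℝ × ℝ → ℝ, ContDiff ℝ ∞ φ → HasCompactSupport φ → tsupport φ ⊆ Ioi 0 ×ˢ Ioi 0 →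
    ∫ t in Ioi (0 : ℝ), ∫ x, (iteratedDeriv n (fun s => φ (x, s)) t
      + iteratedDeriv 1 (fun y => φ (y, t)) x) ∂(μ t) = 0

/-! For `n ≥ 2` the density is written down explicitly as the Wright function `stableDensity`, `x⁻¹
∑ c_m (t x^(-ν))^m / m!` with `c_m = (-1)^m / Γ(-νm)`. Since `|c_m| ≤ (m!)^ν`, the series is entire.
When `ν = 1/n`, raising `m` by `n` lowers the Gamma argument by one, so `Γ(s+1) = sΓ(s)` becomes an
ODE for the Wright function (`egf_wrightCoeff_ode`), which is the PDE in self-similar variables. The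
time derivatives at `t = 0` are read off the coefficients.

The identification with the law goes through the Mellin transform. The inverse Laplace integral,
bent onto the rays of argument `± 3π/4` (`stableDensity_eq_integral`), gives the moments of order
`-p`, `0 < p < 1`, of the series. Those of the law come from integrating its Laplace transform
against `l^(p-1)`. The two agree, and such moments determine a measure on `(0,∞)`
(`Measure.ext_of_lintegral_rpow`). The series is not known in advance to be nonnegative; its
positive and negative parts are therefore compared as measures, and nonnegativity falls out of the
comparison.

The distributional equation follows from the classical one by parts. For `n = 1` the law is `δ_t`,
and the pairing is the integral of a total derivative along the diagonal. The boundary condition is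
a Chernoff bound, the initial condition right-continuity of paths. -/

/-! ### Entire exponential generating functions: differentiation shifts the coefficients. -/

/-- The exponential generating function `∑ c_m z^m / m!`. -/
noncomputable def egf (c : ℕ → ℝ) (z : ℝ) : ℝ :=
  ∑' m, c m * z ^ m / m.factorial

/-- The exponential generating function of `c` converges on the whole line. -/
def EntireEgf (c : ℕ → ℝ) : Prop :=
  ∀ R : ℝ, 0 < R → Summable fun m => |c m| * R ^ m / m.factorial

/-- The shifted sequence `m ↦ c (m + 1)`. -/
def shiftSeq (c : ℕ → ℝ) : ℕ → ℝ := fun m => c (m + 1)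

namespace EntireEgf

variable {c : ℕ → ℝ}

/-- The factor `m + 1` lost in the factorial is at most `2^(m+1)`, so it is absorbed by doubling the
radius. -/
theorem shift (hc : EntireEgf c) : EntireEgf (shiftSeq c) := by
  intro R hR
  have h := ((summable_nat_add_iff 1).2 (hc (2 * R) (by positivity))).mul_left R⁻¹
  refine Summable.of_nonneg_of_le (fun m => by positivity) (fun m => ?_) h
  have h2 : ((m : ℝ) + 1) ≤ 2 ^ (m + 1) := by
    exact_mod_cast (Nat.lt_two_pow_self (n := m + 1)).le
  have hf : (0 : ℝ) < m.factorial := by positivity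
  calc |c (m + 1)| * R ^ m / m.factorial
      = |c (m + 1)| * R ^ m * (m + 1) / ((m + 1) * m.factorial) := by field_simp
    _ ≤ |c (m + 1)| * R ^ m * 2 ^ (m + 1) / ((m + 1) * m.factorial) := by gcongr
    _ = R⁻¹ * (|c (m + 1)| * (2 * R) ^ (m + 1) / (m + 1).factorial) := by
        rw [Nat.factorial_succ]; push_cast; rw [mul_pow]; field_simp; ring

theorem summable (hc : EntireEgf c) (z : ℝ) : Summable fun m => c m * z ^ m / m.factorial := by
  refine Summable.of_norm_bounded (hc (|z| + 1) (by positivity)) fun m => ?_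
  rw [Real.norm_eq_abs, abs_div, abs_mul, abs_pow, Nat.abs_cast]
  gcongr
  linarith

/-- Termwise differentiation on the ball of radius `|z| + 1`, where the differentiated series is
dominated by the shifted series at that radius. -/
theorem hasDerivAt (hc : EntireEgf c) (z : ℝ) : HasDerivAt (egf c) (egf (shiftSeq c) z) z := by
  have hs : Summable fun m : ℕ => |c m| * (m * (|z| + 1) ^ (m - 1)) / m.factorial := by
    rw [← summable_nat_add_iff 1]
    refine (hc.shift (|z| + 1) (by positivity)).congr fun m => ?_
    rw [shiftSeq, Nat.factorial_succ, Nat.add_sub_cancel]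
    have hf : (0 : ℝ) < m.factorial := by positivity
    push_cast
    field_simp
  have key := hasDerivAt_tsum_of_isPreconnected (𝕜 := ℝ) (t := Metric.ball 0 (|z| + 1))
    (g := fun m y => c m * y ^ m / m.factorial)
    (g' := fun m y => c m * (m * y ^ (m - 1)) / m.factorial) hs Metric.isOpen_ball
    (convex_ball _ _).isPreconnected
    (fun m y _ => ((hasDerivAt_pow m y).const_mul (c m)).div_const _) (fun m y hy => by
      have hy' : |y| ≤ |z| + 1 := by simpa using (mem_ball_zero_iff.1 hy).le
      rw [Real.norm_eq_abs, abs_div, abs_mul, abs_mul, abs_pow, Nat.abs_cast, Nat.abs_cast]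
      gcongr) (y₀ := z) (by simp) (hc.summable z) (y := z) (by simp)
  convert! key using 1
  rw [((hs.of_norm_bounded fun m => ?_) : Summable _).tsum_eq_zero_add]
  · simp only [CharP.cast_eq_zero, zero_mul, mul_zero, zero_div, zero_add, egf, shiftSeq]
    refine tsum_congr fun m => ?_
    rw [Nat.factorial_succ, Nat.add_sub_cancel]
    have hf : (0 : ℝ) < m.factorial := by positivity
    push_cast
    field_simp
  · rw [Real.norm_eq_abs, abs_div, abs_mul, abs_mul, abs_pow, Nat.abs_cast, Nat.abs_cast]
    gcongr
    linarith

theorem iterate_shift (hc : EntireEgf c) (k : ℕ) : EntireEgf (shiftSeq^[k] c) := by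
  induction k with
  | zero => exact hc
  | succ k ih => rw [Function.iterate_succ_apply']; exact ih.shift

theorem iteratedDeriv_eq (hc : EntireEgf c) (k : ℕ) :
    iteratedDeriv k (egf c) = egf (shiftSeq^[k] c) := by
  induction k with
  | zero => simp
  | succ k ih =>
    rw [iteratedDeriv_succ, ih, Function.iterate_succ_apply']
    exact funext fun z => ((hc.iterate_shift k).hasDerivAt z).deriv

theorem contDiff (hc : EntireEgf c) : ContDiff ℝ ∞ (egf c) :=
  contDiff_of_differentiable_iteratedDeriv fun m _ => by
    rw [hc.iteratedDeriv_eq]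
    exact fun z => ((hc.iterate_shift m).hasDerivAt z).differentiableAt

end EntireEgf

theorem iterate_shiftSeq (c : ℕ → ℝ) (k m : ℕ) : (shiftSeq^[k] c) m = c (m + k) := by
  induction k generalizing m with
  | zero => rfl
  | succ k ih => rw [Function.iterate_succ_apply', shiftSeq, ih]; congr 1; ring

theorem egf_zero (c : ℕ → ℝ) : egf c 0 = c 0 := by
  rw [egf, tsum_eq_single 0 fun m hm => by simp [hm]]
  simp

/-! ### The Wright coefficients: growth, recurrence and ODE. -/

/-- Reflection formula for `1 / Γ` on the nonpositive half-line (valid also at the poles). -/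
theorem inv_Gamma_neg {z : ℝ} (hz : 0 ≤ z) :
    (Real.Gamma (-z))⁻¹ = Real.Gamma (1 + z) * Real.sin (Real.pi * (1 + z)) / Real.pi := by
  have h := Real.Gamma_mul_Gamma_one_sub (1 + z)
  have hG : 0 < Real.Gamma (1 + z) := Real.Gamma_pos_of_pos (by linarith)
  rw [show 1 - (1 + z) = -z by ring] at h
  have h2 : Real.Gamma (-z) = Real.pi / Real.sin (Real.pi * (1 + z)) / Real.Gamma (1 + z) := by
    rw [← h]; field_simp
  rw [h2, inv_div, div_div_eq_mul_div]

/-- Log-convexity of `Γ` at the convex combination `ν (m + 1) + (1 - ν) · 1`. -/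
theorem Gamma_one_add_mul_le {ν : ℝ} (h0 : 0 < ν) (h1 : ν < 1) (m : ℕ) :
    Real.Gamma (1 + ν * m) ≤ (m.factorial : ℝ) ^ ν := by
  have h := Real.Gamma_mul_add_mul_le_rpow_Gamma_mul_rpow_Gamma (s := m + 1) (t := 1) (a := ν)
    (b := 1 - ν) (by positivity) one_pos h0 (by linarith) (by ring)
  rw [Real.Gamma_one, Real.one_rpow, Real.Gamma_nat_eq_factorial] at h
  convert h using 2 <;> ring

/-- Coefficients of the Wright function which gives the density of a stable law of index `ν`. -/
noncomputable def wrightCoeff (ν : ℝ) (m : ℕ) : ℝ :=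
  (-1) ^ m / Real.Gamma (-(ν * m))

theorem abs_wrightCoeff_le {ν : ℝ} (h0 : 0 < ν) (h1 : ν < 1) (m : ℕ) :
    |wrightCoeff ν m| ≤ (m.factorial : ℝ) ^ ν := by
  have hG : 0 < Real.Gamma (1 + ν * m) := Real.Gamma_pos_of_pos (by positivity)
  rw [wrightCoeff, div_eq_mul_inv, inv_Gamma_neg (by positivity), abs_mul, abs_pow, abs_neg,
    abs_one, one_pow, one_mul, abs_div, abs_mul, abs_of_pos hG, abs_of_pos Real.pi_pos]
  refine le_trans ?_ (Gamma_one_add_mul_le h0 h1 m)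
  rw [div_le_iff₀ Real.pi_pos]
  gcongr
  exact (Real.abs_sin_le_one _).trans (by linarith [Real.pi_gt_three])

/-- The ratio of consecutive terms is `R (m + 1)^(ν - 1)`, which tends to `0`. -/
theorem summable_factorial_rpow {ν : ℝ} (h1 : ν < 1) {R : ℝ} (hR : 0 < R) :
    Summable fun m : ℕ => (m.factorial : ℝ) ^ ν * R ^ m / m.factorial := by
  refine summable_of_ratio_test_tendsto_lt_one (l := 0) one_pos
    (Eventually.of_forall fun m => by positivity) ?_
  have h : Tendsto (fun m : ℕ => R * ((m + 1 : ℕ) : ℝ) ^ (-(1 - ν))) atTop (𝓝 (R * 0)) :=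
    (((tendsto_rpow_neg_atTop (by linarith)).comp tendsto_natCast_atTop_atTop).comp
      (tendsto_add_atTop_nat 1)).const_mul R
  rw [mul_zero] at h
  refine h.congr fun m => ?_
  have hf : (0 : ℝ) < m.factorial := by positivity
  have hm : (0 : ℝ) < (m + 1 : ℕ) := by positivity
  rw [Real.norm_of_nonneg (by positivity), Real.norm_of_nonneg (by positivity),
    Nat.factorial_succ, Nat.cast_mul, Real.mul_rpow hm.le hf.le, neg_sub, Real.rpow_sub_one hm.ne']
  field_simp
  ring

theorem entireEgf_wrightCoeff {ν : ℝ} (h0 : 0 < ν) (h1 : ν < 1) : EntireEgf (wrightCoeff ν) :=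
  fun _ hR => Summable.of_nonneg_of_le (fun m => by positivity)
    (fun m => by gcongr; exact abs_wrightCoeff_le h0 h1 m) (summable_factorial_rpow h1 hR)

/-- With `a = m/n` this is `Γ(-a) = (-a - 1) Γ(-a - 1)`; the choice `ν = 1/n` makes a shift by `n`
move the argument by exactly one. -/
theorem wrightCoeff_recurrence {n : ℕ} (hn : 1 ≤ n) (m : ℕ) :
    (-1) ^ n * wrightCoeff (1 / n) (m + n) + wrightCoeff (1 / n) m
      + 1 / n * m * wrightCoeff (1 / n) m = 0 := by
  have hn' : (n : ℝ) ≠ 0 := by positivity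
  have ha : 0 ≤ 1 / (n : ℝ) * m := by positivity
  have e1 : -(1 / (n : ℝ) * (m + n : ℕ)) = -(1 / (n : ℝ) * m) - 1 := by
    push_cast; field_simp; ring
  have e2 : ((-1 : ℝ)) ^ n * (-1) ^ (m + n) = (-1) ^ m := by
    rw [pow_add, mul_comm, mul_assoc, ← mul_pow]; norm_num
  rw [wrightCoeff, wrightCoeff, e1, ← mul_div_assoc, e2]
  set a := 1 / (n : ℝ) * m
  have hG := Real.Gamma_add_one (s := -a - 1) (by linarith)
  rw [sub_add_cancel] at hG
  rw [hG]
  -- At a pole `Real.Gamma` takes the value `0`; then `Γ(-a)` vanishes too, and with `1/0 = 0` every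
  -- term is zero, in agreement with the zeros of `1/Γ`.
  rcases eq_or_ne (Real.Gamma (-a - 1)) 0 with h | h
  · simp [h]
  · have : -a - 1 ≠ 0 := by linarith
    field_simp
    ring

/-- The Euler operator `z d/dz` multiplies the `m`-th coefficient by `m`. -/
theorem EntireEgf.mul_egf_shift {c : ℕ → ℝ} (hc : EntireEgf c) (z : ℝ) :
    HasSum (fun m : ℕ => m * c m * z ^ m / m.factorial) (z * egf (shiftSeq c) z) := by
  rw [← hasSum_nat_add_iff' 1]
  simp only [Finset.range_one, Finset.sum_singleton, Nat.cast_zero, zero_mul, zero_div, sub_zero]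
  refine ((hc.shift.summable z).hasSum.mul_left z).congr_fun fun m => ?_
  rw [shiftSeq, Nat.factorial_succ]
  have hf : (0 : ℝ) < m.factorial := by positivity
  push_cast
  field_simp
  ring

/-- The ordinary differential equation of the Wright function of index `-1/n`. -/
theorem egf_wrightCoeff_ode {n : ℕ} (hn : 2 ≤ n) (z : ℝ) :
    (-1) ^ n * egf (shiftSeq^[n] (wrightCoeff (1 / n))) z + egf (wrightCoeff (1 / n)) z
      + 1 / n * (z * egf (shiftSeq (wrightCoeff (1 / n))) z) = 0 := by
  have hc : EntireEgf (wrightCoeff (1 / n)) := entireEgf_wrightCoeff (by positivity) (by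
    rw [div_lt_one (by positivity)]; exact_mod_cast hn)
  have h := ((((hc.iterate_shift n).summable z).hasSum.mul_left ((-1) ^ n)).add
    (hc.summable z).hasSum).add ((hc.mul_egf_shift z).mul_left (1 / (n : ℝ)))
  refine h.unique (hasSum_zero.congr_fun fun m => ?_)
  rw [iterate_shiftSeq]
  have := wrightCoeff_recurrence (n := n) (by omega) m
  linear_combination (z ^ m / m.factorial) * this

/-! ### The density as a Wright function: regularity, PDE, behaviour as `t → 0`. -/

/-- The density of the stable subordinator of index `ν` at time `t`, as a Wright function. -/
noncomputable def stableDensity (ν x t : ℝ) : ℝ :=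
  x⁻¹ * egf (wrightCoeff ν) (t * x ^ (-ν))

section Density

variable {n : ℕ}

theorem entireEgf_wrightCoeff_one_div (hn : 2 ≤ n) : EntireEgf (wrightCoeff (1 / n)) :=
  entireEgf_wrightCoeff (by positivity) (by rw [div_lt_one (by positivity)]; exact_mod_cast hn)

theorem contDiff_stableDensity (hn : 2 ≤ n) (x : ℝ) :
    ContDiff ℝ ∞ (fun t => stableDensity (1 / n) x t) :=
  contDiff_const.mul ((entireEgf_wrightCoeff_one_div hn).contDiff.comp
    (contDiff_id.mul contDiff_const))

theorem iteratedDeriv_stableDensity (hn : 2 ≤ n) (k : ℕ) (x t : ℝ) :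
    iteratedDeriv k (fun s => stableDensity (1 / n) x s) t
      = x⁻¹ * ((x ^ (-(1 / n : ℝ))) ^ k
        * egf (shiftSeq^[k] (wrightCoeff (1 / n))) (t * x ^ (-(1 / n : ℝ)))) := by
  have hc := entireEgf_wrightCoeff_one_div hn
  have h := iteratedDeriv_comp_const_mul (n := k) (f := egf (wrightCoeff (1 / n)))
    (hc.contDiff.of_le (by exact_mod_cast le_top)) (x ^ (-(1 / n : ℝ)))
  simp only [stableDensity]
  rw [iteratedDeriv_const_mul_field]
  simp_rw [mul_comm _ (x ^ (-(1 / n : ℝ)))]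
  rw [h, hc.iteratedDeriv_eq]

theorem hasDerivAt_stableDensity (hn : 2 ≤ n) {x : ℝ} (hx : 0 < x) (t : ℝ) :
    HasDerivAt (fun y => stableDensity (1 / n) y t)
      (-(x⁻¹ ^ 2) * (egf (wrightCoeff (1 / n)) (t * x ^ (-(1 / n : ℝ)))
        + 1 / n * (t * x ^ (-(1 / n : ℝ))
          * egf (shiftSeq (wrightCoeff (1 / n))) (t * x ^ (-(1 / n : ℝ)))))) x := by
  have hc := entireEgf_wrightCoeff_one_div hn
  have h1 := (Real.hasDerivAt_rpow_const (p := -(1 / n : ℝ)) (Or.inl hx.ne')).const_mul t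
  have h2 := (hasDerivAt_inv hx.ne').mul ((hc.hasDerivAt (t * x ^ (-(1 / n : ℝ)))).comp x h1)
  refine h2.congr_deriv ?_
  rw [Real.rpow_sub_one hx.ne']
  simp only [Function.comp]
  field_simp
  ring

/-- Since `(x^(-1/n))^n = x⁻¹`, both terms carry the factor `x⁻²`, and what remains is the Wright
ODE at `z = t x^(-1/n)`. -/
theorem leftD_stableDensity (hn : 2 ≤ n) {x : ℝ} (hx : 0 < x) (t : ℝ) :
    leftD n (fun s => stableDensity (1 / n) x s) t
      + leftD 1 (fun y => stableDensity (1 / n) y t) x = 0 := by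
  have hn' : (n : ℝ) ≠ 0 := by positivity
  rw [leftD, leftD, iteratedDeriv_one, (hasDerivAt_stableDensity hn hx t).deriv,
    iteratedDeriv_stableDensity hn, ← Real.rpow_mul_natCast hx.le,
    show -(1 / (n : ℝ)) * n = -1 by field_simp, Real.rpow_neg_one]
  linear_combination (x⁻¹ ^ 2) * egf_wrightCoeff_ode hn (t * x ^ (-(1 / n : ℝ)))

theorem tendsto_stableDensity_time_zero (hn : 2 ≤ n) (x : ℝ) :
    Tendsto (fun t => stableDensity (1 / n) x t) (𝓝[>] 0) (𝓝 0) := by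
  have h := ((contDiff_stableDensity hn x).continuous.tendsto 0).mono_left
    (nhdsWithin_le_nhds (s := Ioi 0))
  -- The constant coefficient is `1 / Γ(0)`, which is `0` by the conventions at the pole.
  simpa [stableDensity, egf_zero, wrightCoeff] using h

/-- At `t = 0` only the coefficient `c_k` survives, and its sign `(-1)^k` cancels that of `leftD`.
-/
theorem tendsto_leftD_stableDensity (hn : 2 ≤ n) (k : ℕ) {x : ℝ} (hx : 0 < x) :
    Tendsto (fun t => leftD k (fun s => stableDensity (1 / n) x s) t) (𝓝[>] 0)
      (𝓝 (Phi ((k : ℝ) / n + 1) x)) := by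
  have h : Continuous fun t => leftD k (fun s => stableDensity (1 / n) x s) t :=
    continuous_const.mul ((contDiff_stableDensity hn x).continuous_iteratedDeriv k
      (by exact_mod_cast le_top))
  convert (h.tendsto 0).mono_left (nhdsWithin_le_nhds (s := Ioi 0)) using 2
  rw [leftD, iteratedDeriv_stableDensity hn, zero_mul, egf_zero, iterate_shiftSeq, wrightCoeff,
    zero_add, Phi, if_pos hx, ← Real.rpow_mul_natCast hx.le, neg_add, Real.rpow_add hx,
    Real.rpow_neg_one, show (1 : ℝ) - (k / n + 1) = -(1 / n * k) by ring,
    show -(1 / (n : ℝ)) * k = -(k / n) by ring]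
  have e : ((-1 : ℝ)) ^ k * (-1) ^ k = 1 := by rw [← mul_pow]; norm_num
  generalize x ^ (-((k : ℝ) / n)) = A, Real.Gamma (-(1 / n * k)) = G
  linear_combination -(A * x⁻¹ / G) * e

theorem continuousOn_stableDensity (hn : 2 ≤ n) :
    ContinuousOn (fun p : ℝ × ℝ => stableDensity (1 / n) p.1 p.2) (Ioi 0 ×ˢ univ) := by
  have hc := (entireEgf_wrightCoeff_one_div hn).contDiff.continuous
  refine ContinuousOn.mul (continuousOn_fst.inv₀ fun p hp => (hp.1 : 0 < p.1).ne')
    (hc.comp_continuousOn (continuousOn_snd.mul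
      (continuousOn_fst.rpow_const fun p hp => Or.inl (hp.1 : 0 < p.1).ne')))

theorem measurable_stableDensity (hn : 2 ≤ n) (t : ℝ) :
    Measurable (fun x => stableDensity (1 / n) x t) := by
  have hc := (entireEgf_wrightCoeff_one_div hn).contDiff.continuous.measurable
  unfold stableDensity
  fun_prop

end Density

/-! ### Contour-integral representation of the density. -/

/-- Identity theorem on a vertical strip, from equality on its real points. -/
theorem eqOn_strip_of_eqOn_real {f g : ℂ → ℂ} {U : Set ℝ} (hU : IsOpen U) (hconv : Convex ℝ U)
    (hf : AnalyticOnNhd ℂ f {z | z.re ∈ U}) (hg : AnalyticOnNhd ℂ g {z | z.re ∈ U})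
    (h : ∀ x ∈ U, f (x : ℂ) = g (x : ℂ)) : EqOn f g {z | z.re ∈ U} := by
  rcases U.eq_empty_or_nonempty with rfl | ⟨t, ht⟩
  · exact fun z hz => hz.elim
  refine AnalyticOnNhd.eqOn_of_preconnected_of_frequently_eq hf hg
    (hconv.linear_preimage Complex.reLm).isPreconnected (z₀ := (t : ℂ)) (by simpa using ht) ?_
  have h_real : ∃ᶠ x : ℝ in 𝓝[≠] t, f (x : ℂ) = g (x : ℂ) :=
    (Eventually.filter_mono nhdsWithin_le_nhds
      ((hU.eventually_mem ht).mono fun x hx => h x hx)).frequently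
  have h_tend : Tendsto (fun x : ℝ => (x : ℂ)) (𝓝[≠] t) (𝓝[≠] (t : ℂ)) := by
    refine tendsto_nhdsWithin_iff.2 ⟨(Complex.continuous_ofReal.tendsto t).mono_left
      nhdsWithin_le_nhds, ?_⟩
    filter_upwards [self_mem_nhdsWithin] with x hx
    simpa using hx
  exact h_tend.frequently h_real

/-- Euler's integral with a complex rate. -/
theorem integral_rpow_mul_cexp {a : ℝ} (ha : 0 < a) {z : ℂ} (hz : z.re < 0) :
    ∫ r in Ioi (0 : ℝ), ((r ^ (a - 1) : ℝ) : ℂ) * Complex.exp (z * r)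
      = (-z) ^ (-(a : ℂ)) * Real.Gamma a := by
  -- Viewed as the complex moment generating function of `r^(a-1) dr`, the integral is analytic on
  -- the left half-plane, so Euler's real formula extends by the identity theorem.
  set μ : Measure ℝ := (volume.restrict (Ioi 0)).withDensity
    (fun r => ENNReal.ofReal (r ^ (a - 1))) with hμ
  have hmeas : Measurable fun r : ℝ => ENNReal.ofReal (r ^ (a - 1)) := by fun_prop
  have hset : Iio 0 ⊆ integrableExpSet id μ := fun l hl => by
    rw [integrableExpSet, mem_ofPred_eq, hμ, integrable_withDensity_iff hmeas
      (ae_of_all _ fun _ => ENNReal.ofReal_lt_top)]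
    have := integrableOn_rpow_mul_exp_neg_mul_rpow (s := a - 1) (p := 1) (b := -l) (by linarith)
      one_pos (by simpa using hl)
    refine Integrable.congr this ?_
    filter_upwards [ae_restrict_mem measurableSet_Ioi] with r hr
    have : 0 ≤ r ^ (a - 1) := Real.rpow_nonneg (le_of_lt hr) _
    simp [ENNReal.toReal_ofReal this, mul_comm]
  have hmgf : ∀ z : ℂ, complexMGF id μ z
      = ∫ r in Ioi (0 : ℝ), ((r ^ (a - 1) : ℝ) : ℂ) * Complex.exp (z * r) := fun z => by
    rw [complexMGF, hμ, integral_withDensity_eq_integral_toReal_smul hmeas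
      (ae_of_all _ fun _ => ENNReal.ofReal_lt_top)]
    refine setIntegral_congr_fun measurableSet_Ioi fun r hr => ?_
    have : 0 ≤ r ^ (a - 1) := Real.rpow_nonneg (le_of_lt hr) _
    simp only [ENNReal.toReal_ofReal this, Complex.real_smul, id]
  have key : EqOn (complexMGF id μ) (fun z => (-z) ^ (-(a : ℂ)) * Real.Gamma a)
      {z | z.re ∈ Iio 0} := by
    refine eqOn_strip_of_eqOn_real isOpen_Iio (convex_Iio 0)
      (analyticOnNhd_complexMGF.mono fun z hz => interior_maximal hset isOpen_Iio hz) ?_ ?_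
    · intro z hz
      have h0 : -z ∈ Complex.slitPlane := Or.inl (by simpa using hz)
      exact ((analyticAt_id.neg).cpow analyticAt_const h0).mul analyticAt_const
    · intro x hx
      have hx' : 0 < -x := by simpa using hx
      have h := Real.integral_rpow_mul_exp_neg_mul_Ioi ha hx'
      simp only [hmgf]
      rw [one_div, Real.inv_rpow hx'.le, ← Real.rpow_neg hx'.le] at h
      rw [← Complex.ofReal_neg, ← Complex.ofReal_neg, ← Complex.ofReal_cpow hx'.le,
        ← Complex.ofReal_mul, ← h, ← integral_complex_ofReal]
      refine setIntegral_congr_fun measurableSet_Ioi fun r _ => ?_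
      simp
  rw [← hmgf]
  exact key hz

theorem re_mul_cexp_mul_I (x φ : ℝ) :
    ((x : ℂ) * Complex.exp (φ * Complex.I)).re = x * Real.cos φ := by
  rw [Complex.re_ofReal_mul, Complex.exp_ofReal_mul_I_re]

theorem norm_cexp_neg_mul_ray (x φ r : ℝ) :
    ‖Complex.exp (-(x * Complex.exp (φ * Complex.I)) * r)‖ = Real.exp (-(x * Real.cos φ) * r) := by
  rw [Complex.norm_exp, Complex.re_mul_ofReal, Complex.neg_re, re_mul_cexp_mul_I]

/-- Euler's integral with the rate on a ray in the right half-plane. -/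
theorem integral_rpow_mul_cexp_ray {a x φ : ℝ} (ha : 0 < a) (hx : 0 < x)
    (hφ : φ ∈ Ioo (-(Real.pi / 2)) (Real.pi / 2)) :
    ∫ r in Ioi (0 : ℝ), ((r ^ (a - 1) : ℝ) : ℂ)
        * Complex.exp (-(x * Complex.exp (φ * Complex.I)) * r)
      = ((x ^ (-a) * Real.Gamma a : ℝ) : ℂ) * Complex.exp (-(φ * a : ℝ) * Complex.I) := by
  have hcos := Real.cos_pos_of_mem_Ioo hφ
  rw [integral_rpow_mul_cexp ha (by rw [Complex.neg_re, re_mul_cexp_mul_I]; nlinarith), neg_neg,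
    Complex.cpow_def_of_ne_zero (by simp [hx.ne']),
    Complex.log_ofReal_mul hx (Complex.exp_ne_zero _), Complex.log_exp
      (by simp; linarith [hφ.1, Real.pi_pos]) (by simp; linarith [hφ.2, Real.pi_pos]),
    Real.rpow_def_of_pos hx, add_mul, Complex.exp_add]
  push_cast
  rw [show (φ : ℂ) * Complex.I * -a = -(φ * a) * Complex.I by ring, mul_neg]
  ring

theorem integrableOn_rpow_mul_cexp_ray {a x φ : ℝ} (ha : 0 < a) (hx : 0 < x)
    (hφ : φ ∈ Ioo (-(Real.pi / 2)) (Real.pi / 2)) :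
    IntegrableOn (fun r : ℝ => ((r ^ (a - 1) : ℝ) : ℂ)
        * Complex.exp (-(x * Complex.exp (φ * Complex.I)) * r)) (Ioi 0) := by
  have hcos := Real.cos_pos_of_mem_Ioo hφ
  have h := integrableOn_rpow_mul_exp_neg_mul_rpow (s := a - 1) (p := 1) (b := x * Real.cos φ)
    (by linarith) one_pos (by positivity)
  refine Integrable.mono' h (by fun_prop) ?_
  filter_upwards [ae_restrict_mem measurableSet_Ioi] with r hr
  rw [norm_mul, norm_cexp_neg_mul_ray, Complex.norm_real,
    Real.norm_of_nonneg (Real.rpow_nonneg (le_of_lt hr) _), Real.rpow_one]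

/-- The integrand of the contour integral for the stable density, along the rays with
argument `± 3π/4`. -/
noncomputable def stableKernel (ν x t r : ℝ) : ℂ :=
  Complex.exp ((3 * Real.pi / 4 : ℝ) * Complex.I)
    * Complex.exp (-(x * Complex.exp ((-(Real.pi / 4) : ℝ) * Complex.I)) * r)
    * Complex.exp (-(t * Complex.exp ((ν * (3 * Real.pi / 4) : ℝ) * Complex.I)) * (r ^ ν : ℝ))

theorem neg_pi_div_four_mem : -(Real.pi / 4) ∈ Ioo (-(Real.pi / 2)) (Real.pi / 2) :=
  ⟨by linarith [Real.pi_pos], by linarith [Real.pi_pos]⟩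

theorem norm_stableKernel (ν x t r : ℝ) :
    ‖stableKernel ν x t r‖ = Real.exp (-(x * Real.cos (Real.pi / 4)) * r)
      * Real.exp (-(t * Real.cos (ν * (3 * Real.pi / 4))) * r ^ ν) := by
  rw [stableKernel, norm_mul, norm_mul, norm_cexp_neg_mul_ray, norm_cexp_neg_mul_ray,
    Complex.norm_exp_ofReal_mul_I, one_mul, Real.cos_neg]

theorem measurable_stableKernel (ν t : ℝ) :
    Measurable (fun p : ℝ × ℝ => stableKernel ν p.1 t p.2) := by
  unfold stableKernel
  fun_prop

/-- Contour-integral representation of the stable density. -/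
theorem stableDensity_eq_integral {ν : ℝ} (h0 : 0 < ν) (h1 : ν < 1) {x t : ℝ} (hx : 0 < x)
    (ht : 0 < t) :
    stableDensity ν x t = (∫ r in Ioi (0 : ℝ), stableKernel ν x t r).im / Real.pi := by
  set b := x * Real.cos (Real.pi / 4) with hb
  have hb0 : 0 < b := mul_pos hx (Real.cos_pos_of_mem_Ioo
    ⟨by linarith [Real.pi_pos], by linarith [Real.pi_pos]⟩)
  let C : ℕ → ℂ := fun m => Complex.exp ((3 * Real.pi / 4 : ℝ) * Complex.I)
    * ((-(t * Complex.exp ((ν * (3 * Real.pi / 4) : ℝ) * Complex.I))) ^ m / m.factorial)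
  let F : ℕ → ℝ → ℂ := fun m r => C m * (((r ^ ((ν * m + 1) - 1) : ℝ) : ℂ)
    * Complex.exp (-(x * Complex.exp ((-(Real.pi / 4) : ℝ) * Complex.I)) * r))
  have ha : ∀ m : ℕ, 0 < ν * m + 1 := fun m => by positivity
  have hC : ∀ m, ‖C m‖ = t ^ m / m.factorial := fun m => by
    simp only [C]
    rw [norm_mul, norm_div, norm_pow, norm_neg, norm_mul, Complex.norm_exp_ofReal_mul_I,
      Complex.norm_exp_ofReal_mul_I, Complex.norm_real, Real.norm_of_nonneg ht.le,
      Complex.norm_natCast, one_mul, mul_one]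
  have hFi : ∀ m, Integrable (F m) (volume.restrict (Ioi 0)) := fun m =>
    (integrableOn_rpow_mul_cexp_ray (ha m) hx neg_pi_div_four_mem).const_mul _
  have hnorm : ∀ m, ∫ r in Ioi (0 : ℝ), ‖F m r‖
      = t ^ m / m.factorial * (b ^ (-(ν * m + 1)) * Real.Gamma (ν * m + 1)) := fun m => by
    have h := Real.integral_rpow_mul_exp_neg_mul_Ioi (ha m) hb0
    rw [one_div, Real.inv_rpow hb0.le, ← Real.rpow_neg hb0.le] at h
    rw [← h, ← integral_const_mul]
    refine setIntegral_congr_fun measurableSet_Ioi fun r hr => ?_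
    simp only [F]
    rw [norm_mul (C m), hC, norm_mul, norm_cexp_neg_mul_ray, Complex.norm_real, Real.cos_neg,
      Real.norm_of_nonneg (Real.rpow_nonneg (le_of_lt hr) _), neg_mul]
  -- Absolute summability, again from `Γ(1 + νm) ≤ (m!)^ν`, allows the expansion of `exp(-t s^ν)` to
  -- be integrated term by term.
  have hsum : Summable fun m => ∫ r in Ioi (0 : ℝ), ‖F m r‖ := by
    have h := (summable_factorial_rpow h1 (R := t * b ^ (-ν)) (by positivity)).mul_left b⁻¹
    refine Summable.of_nonneg_of_le (fun m => by positivity) (fun m => ?_) h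
    rw [hnorm, neg_add, Real.rpow_add hb0, Real.rpow_neg_one, ← neg_mul,
      Real.rpow_mul_natCast hb0.le, mul_pow, add_comm (ν * m)]
    calc t ^ m / m.factorial * ((b ^ (-ν)) ^ m * b⁻¹ * Real.Gamma (1 + ν * m))
        ≤ t ^ m / m.factorial * ((b ^ (-ν)) ^ m * b⁻¹ * (m.factorial : ℝ) ^ ν) := by
          gcongr; exact Gamma_one_add_mul_le h0 h1 m
      _ = _ := by ring
  have hmain := hasSum_integral_of_summable_integral_norm hFi hsum
  have hK : ∫ r in Ioi (0 : ℝ), (∑' m, F m r) = ∫ r in Ioi (0 : ℝ), stableKernel ν x t r := by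
    refine setIntegral_congr_fun measurableSet_Ioi fun r hr => ?_
    have h := (NormedSpace.expSeries_div_hasSum_exp
      (-(t * Complex.exp ((ν * (3 * Real.pi / 4) : ℝ) * Complex.I)) * (r ^ ν : ℝ))).mul_left
      (Complex.exp ((3 * Real.pi / 4 : ℝ) * Complex.I)
        * Complex.exp (-(x * Complex.exp ((-(Real.pi / 4) : ℝ) * Complex.I)) * r))
    rw [← Complex.exp_eq_exp_ℂ] at h
    rw [stableKernel, ← h.tsum_eq]
    refine tsum_congr fun m => ?_
    simp only [F, C]
    rw [add_sub_cancel_right, Real.rpow_mul_natCast (le_of_lt hr), mul_pow]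
    push_cast
    ring
  rw [hK] at hmain
  have him := (Complex.hasSum_im hmain).div_const Real.pi
  rw [← him.tsum_eq, stableDensity, egf, ← tsum_mul_left]
  refine tsum_congr fun m => ?_
  -- The phases `3π/4`, `3πνm/4` and `(π/4)(νm + 1)` add up to `π(1 + νm)`; its sine is the one in
  -- the reflection formula for `1/Γ(-νm)`.
  have hI : ∫ r in Ioi (0 : ℝ), F m r
      = ((x ^ (-(ν * m + 1)) * Real.Gamma (ν * m + 1) * ((-t) ^ m / m.factorial) : ℝ) : ℂ)
        * Complex.exp ((Real.pi * (1 + ν * m) : ℝ) * Complex.I) := by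
    simp only [F]
    rw [integral_const_mul, integral_rpow_mul_cexp_ray (ha m) hx neg_pi_div_four_mem]
    simp only [C]
    rw [← neg_mul (t : ℂ), mul_pow, ← Complex.exp_nat_mul,
      show ((Real.pi * (1 + ν * m) : ℝ) : ℂ) * Complex.I
        = (3 * Real.pi / 4 : ℝ) * Complex.I + (m * ((ν * (3 * Real.pi / 4) : ℝ) * Complex.I)
          + -(-(Real.pi / 4) * (ν * m + 1) : ℝ) * Complex.I) by push_cast; ring,
      Complex.exp_add, Complex.exp_add]
    push_cast
    ring
  rw [hI, Complex.im_ofReal_mul, Complex.exp_ofReal_mul_I_im, wrightCoeff, div_eq_mul_inv _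
    (Real.Gamma _), inv_Gamma_neg (by positivity), neg_add, Real.rpow_add hx, Real.rpow_neg_one,
    ← neg_mul, Real.rpow_mul_natCast hx.le, mul_pow, add_comm (ν * m), neg_pow t]
  ring

/-! ### Boundary value at `x = 0` and Mellin transform of the density. -/

section Mellin

variable {n : ℕ}

/-- The reason for the angle `3π/4`: it exceeds `π/2`, so `e^(sx)` decays along the ray, while `ν ≤
1/2` keeps `ν · 3π/4` below `π/2`, so `exp(-t s^ν)` decays as well, uniformly down to `x = 0`. -/
theorem one_div_mul_angle_mem (hn : 2 ≤ n) :
    1 / (n : ℝ) * (3 * Real.pi / 4) ∈ Ioo (-(Real.pi / 2)) (Real.pi / 2) := by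
  have h2 : 1 / (n : ℝ) ≤ 1 / 2 := by
    gcongr; exact_mod_cast hn
  have h0 : 0 < 1 / (n : ℝ) := by positivity
  constructor <;> nlinarith [Real.pi_pos]

/-- The substitution `r = u^n` turns this into Euler's integral with exponent `n p`. -/
theorem integral_rpow_mul_cexp_rpow_ray (hn : 2 ≤ n) {p t : ℝ} (hp : 0 < p) (ht : 0 < t) :
    ∫ r in Ioi (0 : ℝ), ((r ^ (p - 1) : ℝ) : ℂ)
      * Complex.exp (-(t * Complex.exp ((1 / (n : ℝ) * (3 * Real.pi / 4) : ℝ) * Complex.I))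
          * (r ^ (1 / (n : ℝ)) : ℝ))
      = ((n * (t ^ (-(n * p)) * Real.Gamma (n * p)) : ℝ) : ℂ)
        * Complex.exp (-(3 * Real.pi / 4 * p : ℝ) * Complex.I) := by
  have hn0 : (0 : ℝ) < n := by positivity
  have h := integral_rpow_mul_cexp_ray (a := n * p) (by positivity) ht (one_div_mul_angle_mem hn)
  rw [← integral_comp_rpow_Ioi_of_pos hn0]
  rw [show 1 / (n : ℝ) * (3 * Real.pi / 4) * (n * p) = 3 * Real.pi / 4 * p by field_simp] at h
  rw [Complex.ofReal_mul (n : ℝ), mul_assoc ((n : ℝ) : ℂ), ← h, ← integral_const_mul]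
  refine setIntegral_congr_fun measurableSet_Ioi fun u hu => ?_
  have hu' : 0 < u := hu
  have e1 : (u ^ (n : ℝ)) ^ (1 / (n : ℝ)) = u := by
    rw [← Real.rpow_mul hu'.le, mul_one_div_cancel hn0.ne', Real.rpow_one]
  have e2 : u ^ ((n : ℝ) * p - 1) = u ^ ((n : ℝ) - 1) * (u ^ (n : ℝ)) ^ (p - 1) := by
    rw [← Real.rpow_mul hu'.le, ← Real.rpow_add hu']; congr 1; ring
  simp only [e1, e2, Complex.real_smul]
  push_cast
  ring

theorem integrableOn_rpow_mul_exp_neg_stable (hn : 2 ≤ n) {p t : ℝ} (hp : 0 < p) (ht : 0 < t) :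
    IntegrableOn (fun r => r ^ (p - 1)
      * Real.exp (-(t * Real.cos (1 / (n : ℝ) * (3 * Real.pi / 4))) * r ^ (1 / (n : ℝ)))) (Ioi 0) :=
  integrableOn_rpow_mul_exp_neg_mul_rpow (by linarith) (by positivity)
    (mul_pos ht (Real.cos_pos_of_mem_Ioo (one_div_mul_angle_mem hn)))

theorem tendsto_stableDensity_space_zero (hn : 2 ≤ n) {t : ℝ} (ht : 0 < t) :
    Tendsto (fun x => stableDensity (1 / n) x t) (𝓝[>] 0) (𝓝 0) := by
  have hν0 : 0 < 1 / (n : ℝ) := by positivity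
  have hν1 : 1 / (n : ℝ) < 1 := by rw [div_lt_one (by positivity)]; exact_mod_cast hn
  have hlim : Tendsto (fun x => ∫ r in Ioi (0 : ℝ), stableKernel (1 / n) x t r) (𝓝[>] 0)
      (𝓝 (∫ r in Ioi (0 : ℝ), stableKernel (1 / n) 0 t r)) := by
    refine tendsto_integral_filter_of_dominated_convergence _
      (Eventually.of_forall fun x => ?_) ?_ (integrableOn_rpow_mul_exp_neg_stable hn one_pos ht) ?_
    · exact ((measurable_stableKernel (1 / n) t).comp
        (measurable_const.prodMk measurable_id)).aestronglyMeasurable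
    · filter_upwards [self_mem_nhdsWithin] with x hx
      filter_upwards [ae_restrict_mem measurableSet_Ioi] with r hr
      rw [norm_stableKernel, sub_self, Real.rpow_zero]
      gcongr
      rw [Real.exp_le_one_iff, neg_mul, neg_nonpos]
      have hx' : 0 < x := hx
      have hr' : 0 < r := hr
      have : 0 < Real.cos (Real.pi / 4) := Real.cos_pos_of_mem_Ioo
        ⟨by linarith [Real.pi_pos], by linarith [Real.pi_pos]⟩
      positivity
    · refine ae_of_all _ fun r => ?_
      have : Continuous fun x => stableKernel (1 / n) x t r := by
        unfold stableKernel
        fun_prop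
      exact (this.tendsto 0).mono_left nhdsWithin_le_nhds
  -- At `x = 0` the integral has phase `-3π/4`, cancelling the direction of the ray, so the limit is
  -- real.
  have hval : (∫ r in Ioi (0 : ℝ), stableKernel (1 / n) 0 t r).im = 0 := by
    have h := integral_rpow_mul_cexp_rpow_ray hn one_pos ht
    have h2 : ∫ r in Ioi (0 : ℝ), stableKernel (1 / n) 0 t r
        = Complex.exp ((3 * Real.pi / 4 : ℝ) * Complex.I)
          * (((n * (t ^ (-(n * 1 : ℝ)) * Real.Gamma (n * 1)) : ℝ) : ℂ)
            * Complex.exp (-(3 * Real.pi / 4 * 1 : ℝ) * Complex.I)) := by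
      rw [← h, ← integral_const_mul]
      refine setIntegral_congr_fun measurableSet_Ioi fun r _ => ?_
      simp [stableKernel]
    rw [h2, mul_left_comm, ← Complex.exp_add, mul_one, mul_one, neg_mul, add_neg_cancel, Complex.exp_zero,
      mul_one, Complex.ofReal_im]
  have h := ((Complex.continuous_im.tendsto _).comp hlim).div_const Real.pi
  rw [hval, zero_div] at h
  refine h.congr' ?_
  filter_upwards [self_mem_nhdsWithin] with x hx
  exact (stableDensity_eq_integral hν0 hν1 hx ht).symm

theorem integral_rpow_mul_stableKernel_space (ν t : ℝ) {p r : ℝ} (hp1 : p < 1) (hr : 0 < r) :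
    ∫ x in Ioi (0 : ℝ), ((x ^ (-p) : ℝ) : ℂ) * stableKernel ν x t r
      = Complex.exp ((Real.pi - 3 * Real.pi / 4 * (-p) - Real.pi * p : ℝ) * Complex.I)
        * (Real.Gamma (1 - p) : ℂ) * (((r ^ (p - 1) : ℝ) : ℂ)
        * Complex.exp (-(t * Complex.exp ((ν * (3 * Real.pi / 4) : ℝ) * Complex.I))
          * (r ^ ν : ℝ))) := by
  have h := integral_rpow_mul_cexp_ray (a := 1 - p) (by linarith) hr neg_pi_div_four_mem
  rw [show 1 - p - 1 = -p by ring, show -(1 - p) = p - 1 by ring] at h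
  rw [show ((Real.pi - 3 * Real.pi / 4 * (-p) - Real.pi * p : ℝ) : ℂ) * Complex.I
    = (3 * Real.pi / 4 : ℝ) * Complex.I + -(-(Real.pi / 4) * (1 - p) : ℝ) * Complex.I by
      push_cast; ring, Complex.exp_add]
  calc _ = ∫ x in Ioi (0 : ℝ), Complex.exp ((3 * Real.pi / 4 : ℝ) * Complex.I)
        * Complex.exp (-(t * Complex.exp ((ν * (3 * Real.pi / 4) : ℝ) * Complex.I)) * (r ^ ν : ℝ))
        * (((x ^ (-p) : ℝ) : ℂ)
          * Complex.exp (-(r * Complex.exp ((-(Real.pi / 4) : ℝ) * Complex.I)) * x)) := by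
        refine setIntegral_congr_fun measurableSet_Ioi fun x _ => ?_
        simp only [stableKernel]
        rw [show -((r : ℂ) * Complex.exp ((-(Real.pi / 4) : ℝ) * Complex.I)) * x
          = -(x * Complex.exp ((-(Real.pi / 4) : ℝ) * Complex.I)) * r by ring]
        ring
    _ = _ := by
        rw [integral_const_mul, h]
        push_cast
        ring

/-- Justifies Fubini. Integrating the norm in `x` needs `p < 1` and leaves a multiple of `r^(p-1)`,
integrable at `r = 0` because `p > 0`. -/
theorem integrable_rpow_mul_stableKernel (hn : 2 ≤ n) {p t : ℝ} (hp0 : 0 < p) (hp1 : p < 1)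
    (ht : 0 < t) :
    Integrable (fun z : ℝ × ℝ => ((z.1 ^ (-p) : ℝ) : ℂ) * stableKernel (1 / n) z.1 t z.2)
      ((volume.restrict (Ioi 0)).prod (volume.restrict (Ioi 0))) := by
  have hc : 0 < Real.cos (Real.pi / 4) := Real.cos_pos_of_mem_Ioo
    ⟨by linarith [Real.pi_pos], by linarith [Real.pi_pos]⟩
  have hmeas : Measurable fun z : ℝ × ℝ =>
      ((z.1 ^ (-p) : ℝ) : ℂ) * stableKernel (1 / n) z.1 t z.2 :=
    (by fun_prop : Measurable fun z : ℝ × ℝ => ((z.1 ^ (-p) : ℝ) : ℂ)).mul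
      (measurable_stableKernel _ _)
  have hnorm : ∀ r x : ℝ, x ∈ Ioi (0 : ℝ) → ‖((x ^ (-p) : ℝ) : ℂ) * stableKernel (1 / n) x t r‖
      = Real.exp (-(t * Real.cos (1 / (n : ℝ) * (3 * Real.pi / 4))) * r ^ (1 / (n : ℝ)))
        * (x ^ ((1 - p) - 1) * Real.exp (-(Real.cos (Real.pi / 4) * r * x))) := by
    intro r x hx
    rw [norm_mul, Complex.norm_real, Real.norm_of_nonneg (Real.rpow_nonneg (le_of_lt hx) _),
      norm_stableKernel, show 1 - p - 1 = -p by ring,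
      show -(x * Real.cos (Real.pi / 4)) * r = -(Real.cos (Real.pi / 4) * r * x) by ring]
    ring
  rw [integrable_prod_iff' hmeas.aestronglyMeasurable]
  constructor
  · filter_upwards [ae_restrict_mem measurableSet_Ioi] with r hr
    have hr' : 0 < r := hr
    have h := (integrableOn_rpow_mul_exp_neg_mul_rpow (s := 1 - p - 1) (p := 1)
      (b := Real.cos (Real.pi / 4) * r) (by linarith) one_pos (by positivity)).const_mul
      (Real.exp (-(t * Real.cos (1 / (n : ℝ) * (3 * Real.pi / 4))) * r ^ (1 / (n : ℝ))))
    refine Integrable.mono' h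
      (hmeas.comp (measurable_id.prodMk measurable_const)).aestronglyMeasurable ?_
    filter_upwards [ae_restrict_mem measurableSet_Ioi] with x hx
    rw [hnorm r x hx, Real.rpow_one, neg_mul (Real.cos (Real.pi / 4) * r)]
  · refine ((integrableOn_rpow_mul_exp_neg_stable hn hp0 ht).const_mul
      (Real.cos (Real.pi / 4) ^ (p - 1) * Real.Gamma (1 - p))).congr ?_
    filter_upwards [ae_restrict_mem measurableSet_Ioi] with r hr
    have hr' : 0 < r := hr
    have h := Real.integral_rpow_mul_exp_neg_mul_Ioi (a := 1 - p)
      (r := Real.cos (Real.pi / 4) * r) (by linarith) (by positivity)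
    rw [one_div, Real.inv_rpow (by positivity), ← Real.rpow_neg (by positivity), neg_sub,
      Real.mul_rpow hc.le hr'.le] at h
    rw [setIntegral_congr_fun measurableSet_Ioi (hnorm r), integral_const_mul, h]
    ring

theorem stableDensity_mellin_aux (hn : 2 ≤ n) {p t : ℝ} (ht : 0 < t) :
    EqOn (fun x => x ^ (-p) * stableDensity (1 / n) x t)
      (fun x => (∫ r in Ioi (0 : ℝ), ((x ^ (-p) : ℝ) : ℂ) * stableKernel (1 / n) x t r).im
        / Real.pi) (Ioi 0) := fun x hx => by
  simp only
  rw [stableDensity_eq_integral (by positivity)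
    (by rw [div_lt_one (by positivity)]; exact_mod_cast hn) hx ht, integral_const_mul,
    Complex.im_ofReal_mul, mul_div_assoc]

theorem integrableOn_rpow_mul_stableDensity (hn : 2 ≤ n) {p t : ℝ} (hp0 : 0 < p) (hp1 : p < 1)
    (ht : 0 < t) : IntegrableOn (fun x => x ^ (-p) * stableDensity (1 / n) x t) (Ioi 0) := by
  have h := (integrable_rpow_mul_stableKernel hn hp0 hp1 ht).integral_prod_left
  exact (integrableOn_congr_fun (stableDensity_mellin_aux hn ht) measurableSet_Ioi).2
    (h.im.div_const Real.pi)

/-- Negative fractional moments of the stable density. -/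
theorem integral_rpow_mul_stableDensity (hn : 2 ≤ n) {p t : ℝ} (hp0 : 0 < p) (hp1 : p < 1)
    (ht : 0 < t) : ∫ x in Ioi (0 : ℝ), x ^ (-p) * stableDensity (1 / n) x t
      = n * (t ^ (-(n * p)) * Real.Gamma (n * p)) / Real.Gamma p := by
  have hI := integrable_rpow_mul_stableKernel hn hp0 hp1 ht
  have him := integral_im (𝕜 := ℂ) hI.integral_prod_left
  rw [setIntegral_congr_fun measurableSet_Ioi (stableDensity_mellin_aux hn ht), integral_div]
  change ∫ x in Ioi (0 : ℝ), (∫ r in Ioi (0 : ℝ),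
    ((x ^ (-p) : ℝ) : ℂ) * stableKernel (1 / n) x t r).im = _ at him
  rw [him, integral_integral_swap hI, setIntegral_congr_fun measurableSet_Ioi
    (fun r hr => integral_rpow_mul_stableKernel_space (1 / n) t hp1 hr), integral_const_mul,
    integral_rpow_mul_cexp_rpow_ray hn hp0 ht]
  -- The total phase is `π - πp`; its imaginary part `sin(πp)`, with `Γ(1 - p)` and the factor
  -- `1/π`, gives `1/Γ(p)` by reflection.
  have e : Complex.exp ((Real.pi - 3 * Real.pi / 4 * (-p) - Real.pi * p : ℝ) * Complex.I)
        * (Real.Gamma (1 - p) : ℂ) * (((n * (t ^ (-(n * p)) * Real.Gamma (n * p)) : ℝ) : ℂ)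
          * Complex.exp (-(3 * Real.pi / 4 * p : ℝ) * Complex.I))
      = ((Real.Gamma (1 - p) * (n * (t ^ (-(n * p)) * Real.Gamma (n * p))) : ℝ) : ℂ)
        * Complex.exp ((Real.pi - Real.pi * p : ℝ) * Complex.I) := by
    rw [show ((Real.pi - Real.pi * p : ℝ) : ℂ) * Complex.I
      = (Real.pi - 3 * Real.pi / 4 * (-p) - Real.pi * p : ℝ) * Complex.I
        + -(3 * Real.pi / 4 * p : ℝ) * Complex.I by push_cast; ring, Complex.exp_add]
    push_cast
    ring
  rw [e, RCLike.im_to_complex, Complex.im_ofReal_mul, Complex.exp_ofReal_mul_I_im,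
    Real.sin_pi_sub]
  have hG := Real.Gamma_mul_Gamma_one_sub p
  have hG0 := Real.Gamma_pos_of_pos hp0
  have hs : 0 < Real.sin (Real.pi * p) := Real.sin_pos_of_pos_of_lt_pi (by positivity)
    (by nlinarith [Real.pi_pos])
  rw [eq_div_iff hs.ne'] at hG
  rw [div_eq_div_iff Real.pi_pos.ne' hG0.ne']
  linear_combination (n * (t ^ (-(n * p)) * Real.Gamma (n * p))) * hG

end Mellin

/-! ### Consequences of the Laplace transform: small values, the case `ν = 1`, negative moments. -/

section StableLaw

/-- A probability measure on the line with the Laplace transform `exp (-t l ^ ν)`. -/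
def HasStableLaplace (ν t : ℝ) (μ : Measure ℝ) : Prop :=
  ∀ l : ℝ, 0 < l → ∫ x, Real.exp (-l * x) ∂μ = Real.exp (-t * l ^ ν)

variable {ν t : ℝ} {μ : Measure ℝ}

/-- A nonintegrable function has Bochner integral `0`, whereas the prescribed value is positive. -/
theorem HasStableLaplace.integrable (h : HasStableLaplace ν t μ) {l : ℝ} (hl : 0 < l) :
    Integrable (fun x => Real.exp (-l * x)) μ :=
  Integrable.of_integral_ne_zero (by rw [h l hl]; positivity)

/-- Chernoff's bound with rate `l = 1/ε`. -/
theorem HasStableLaplace.measureReal_Iic_le [IsFiniteMeasure μ] (h : HasStableLaplace ν t μ)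
    {ε : ℝ} (hε : 0 < ε) :
    μ.real (Iic ε) ≤ Real.exp 1 * Real.exp (-t * ε ^ (-ν)) := by
  have h1 := measure_le_le_exp_mul_mgf (X := id) (μ := μ) ε (t := -ε⁻¹)
    (by simpa using hε.le) (h.integrable (inv_pos.2 hε))
  have h2 := h ε⁻¹ (inv_pos.2 hε)
  rw [Real.inv_rpow hε.le, ← Real.rpow_neg hε.le] at h2
  simp only [mgf, id, h2, neg_neg, inv_mul_cancel₀ hε.ne'] at h1
  exact h1

/-- With `y = ε^(-ν) → ∞` the factor `1/ε` is the power `y^(1/ν)`, beaten by `exp(-t y)`. -/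
theorem HasStableLaplace.tendsto_measureReal_Iic_div [IsFiniteMeasure μ]
    (h : HasStableLaplace ν t μ) (hν : 0 < ν) (ht : 0 < t) :
    Tendsto (fun ε : ℝ => μ.real (Iic ε) / ε) (𝓝[>] 0) (𝓝 0) := by
  have hlim : Tendsto (fun ε : ℝ => Real.exp 1 * ((ε ^ (-ν)) ^ (1 / ν)
      * Real.exp (-t * ε ^ (-ν)))) (𝓝[>] 0) (𝓝 (Real.exp 1 * 0)) :=
    ((tendsto_rpow_mul_exp_neg_mul_atTop_nhds_zero (1 / ν) t ht).comp
      (tendsto_rpow_neg_nhdsGT_zero (neg_lt_zero.2 hν))).const_mul _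
  rw [mul_zero] at hlim
  refine squeeze_zero' ?_ ?_ hlim
  · filter_upwards [self_mem_nhdsWithin] with ε hε
    exact div_nonneg measureReal_nonneg (le_of_lt hε)
  · filter_upwards [self_mem_nhdsWithin] with ε hε
    have hε' : 0 < ε := hε
    rw [← Real.rpow_mul hε'.le, show -ν * (1 / ν) = -1 by field_simp, Real.rpow_neg_one,
      div_eq_inv_mul, mul_left_comm]
    gcongr
    exact h.measureReal_Iic_le hε'

theorem HasStableLaplace.measure_Iic_zero [IsFiniteMeasure μ]
    (h : HasStableLaplace ν t μ) (hν : 0 < ν) (ht : 0 < t) : μ (Iic 0) = 0 := by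
  have hid : Tendsto (fun ε : ℝ => ε) (𝓝[>] 0) (𝓝 0) := tendsto_id.mono_left nhdsWithin_le_nhds
  have hlim := (h.tendsto_measureReal_Iic_div hν ht).mul hid
  rw [mul_zero] at hlim
  have hle : μ.real (Iic 0) ≤ 0 := ge_of_tendsto hlim <| by
    filter_upwards [self_mem_nhdsWithin] with ε hε
    have hε' : 0 < ε := hε
    rw [div_mul_cancel₀ _ hε'.ne']
    exact measureReal_mono (Iic_subset_Iic.2 hε'.le)
  exact (measureReal_eq_zero_iff).1 (le_antisymm hle measureReal_nonneg)

theorem HasStableLaplace.ae_pos [IsFiniteMeasure μ]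
    (h : HasStableLaplace ν t μ) (hν : 0 < ν) (ht : 0 < t) : ∀ᵐ x ∂μ, 0 < x := by
  filter_upwards [measure_eq_zero_iff_ae_notMem.1 (h.measure_Iic_zero hν ht)] with x hx
  exact not_le.1 hx

/-- The transform at `l = 1` and `l = 2` shows that `e^(-x)` has mean `e^(-t)` and variance zero. -/
theorem HasStableLaplace.eq_dirac [IsProbabilityMeasure μ] (h : HasStableLaplace 1 t μ) :
    μ = Measure.dirac t := by
  have i1 := h.integrable one_pos
  have i2 := h.integrable two_pos
  have e1 := h 1 one_pos
  have e2 := h 2 two_pos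
  have hsq : ∀ x : ℝ, (Real.exp (-1 * x) - Real.exp (-t)) ^ 2
      = Real.exp (-2 * x) - 2 * Real.exp (-t) * Real.exp (-1 * x) + Real.exp (-t) ^ 2 := by
    intro x
    rw [show -2 * x = -1 * x + -1 * x by ring, Real.exp_add]
    ring
  have i3 : Integrable (fun x => Real.exp (-2 * x) - 2 * Real.exp (-t) * Real.exp (-1 * x)) μ :=
    i2.sub (i1.const_mul _)
  have hint : Integrable (fun x : ℝ => (Real.exp (-1 * x) - Real.exp (-t)) ^ 2) μ := by
    simp only [hsq]
    exact i3.add (integrable_const _)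
  have hzero : ∫ x, (Real.exp (-1 * x) - Real.exp (-t)) ^ 2 ∂μ = 0 := by
    simp only [hsq]
    rw [integral_add i3 (integrable_const _),
      integral_sub i2 (i1.const_mul _), integral_const_mul, e1, e2]
    simp only [Real.rpow_one, integral_const, probReal_univ, smul_eq_mul]
    rw [show -t * 2 = -t + -t by ring, Real.exp_add]
    ring_nf
  have hae := (integral_eq_zero_iff_of_nonneg (fun x => sq_nonneg _) hint).1 hzero
  have hae' : (fun x : ℝ => x) =ᵐ[μ] fun _ => t := by
    filter_upwards [hae] with x hx
    have hx' := Real.exp_injective (sub_eq_zero.1 (pow_eq_zero_iff two_ne_zero |>.1 hx))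
    linarith
  calc μ = μ.map (fun x => x) := Measure.map_id'.symm
    _ = μ.map (fun _ => t) := Measure.map_congr hae'
    _ = Measure.dirac t := by simp [Measure.map_const]

theorem lintegral_rpow_mul_exp_neg {p x : ℝ} (hp : 0 < p) (hx : 0 < x) :
    ∫⁻ l in Ioi (0 : ℝ), ENNReal.ofReal (l ^ (p - 1) * Real.exp (-l * x))
      = ENNReal.ofReal (Real.Gamma p) * ENNReal.ofReal (x ^ (-p)) := by
  have h := Real.integral_rpow_mul_exp_neg_mul_Ioi hp hx
  have hi := integrableOn_rpow_mul_exp_neg_mul_rpow (s := p - 1) (p := 1) (b := x) (by linarith)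
    one_pos hx
  rw [one_div, Real.inv_rpow hx.le, ← Real.rpow_neg hx.le] at h
  rw [← ENNReal.ofReal_mul (Real.Gamma_pos_of_pos hp).le, mul_comm (Real.Gamma p), ← h,
    ofReal_integral_eq_lintegral_ofReal]
  · exact lintegral_congr fun l => by rw [neg_mul, mul_comm x l]
  · refine hi.congr_fun (fun l _ => ?_) measurableSet_Ioi
    simp
  · filter_upwards [ae_restrict_mem measurableSet_Ioi] with l hl
    exact mul_nonneg (Real.rpow_nonneg (le_of_lt hl) _) (Real.exp_pos _).le

/-- Negative fractional moments of the stable law. -/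
theorem HasStableLaplace.lintegral_rpow [IsFiniteMeasure μ] (h : HasStableLaplace ν t μ)
    (hν : 0 < ν) (ht : 0 < t) {p : ℝ} (hp : 0 < p) :
    ∫⁻ x, ENNReal.ofReal (x ^ (-p)) ∂μ
      = ENNReal.ofReal (t ^ (-p / ν) * (1 / ν) * Real.Gamma (p / ν) / Real.Gamma p) := by
  have hΓ := Real.Gamma_pos_of_pos hp
  have hpos := h.ae_pos hν ht
  have hmul : ENNReal.ofReal (Real.Gamma p) * ∫⁻ x, ENNReal.ofReal (x ^ (-p)) ∂μ
      = ENNReal.ofReal (t ^ (-p / ν) * (1 / ν) * Real.Gamma (p / ν)) := by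
    rw [← lintegral_const_mul _ (by fun_prop)]
    calc _ = ∫⁻ x, (∫⁻ l in Ioi (0 : ℝ), ENNReal.ofReal (l ^ (p - 1) * Real.exp (-l * x))) ∂μ := by
          refine lintegral_congr_ae ?_
          filter_upwards [hpos] with x hx
          exact (lintegral_rpow_mul_exp_neg hp hx).symm
      _ = ∫⁻ l in Ioi (0 : ℝ), ∫⁻ x, ENNReal.ofReal (l ^ (p - 1) * Real.exp (-l * x)) ∂μ :=
          lintegral_lintegral_swap (by fun_prop)
      _ = ∫⁻ l in Ioi (0 : ℝ), ENNReal.ofReal (l ^ (p - 1) * Real.exp (-t * l ^ ν)) := by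
          refine setLIntegral_congr_fun measurableSet_Ioi fun l hl => ?_
          have hl' : 0 ≤ l ^ (p - 1) := Real.rpow_nonneg (le_of_lt hl) _
          simp only [ENNReal.ofReal_mul hl']
          rw [lintegral_const_mul _ (by fun_prop), ← h l hl,
            ofReal_integral_eq_lintegral_ofReal (h.integrable hl)
              (ae_of_all _ fun _ => (Real.exp_pos _).le)]
      _ = _ := by
          have e := integral_rpow_mul_exp_neg_mul_rpow (p := ν) (q := p - 1) (b := t) hν
            (by linarith) ht
          rw [sub_add_cancel] at e
          rw [← e, ofReal_integral_eq_lintegral_ofReal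
            (integrableOn_rpow_mul_exp_neg_mul_rpow (by linarith) hν ht)]
          filter_upwards [ae_restrict_mem measurableSet_Ioi] with l hl
          exact mul_nonneg (Real.rpow_nonneg (le_of_lt hl) _) (Real.exp_pos _).le
  rw [ENNReal.ofReal_div_of_pos hΓ, ← hmul,
    mul_comm, ENNReal.mul_div_cancel_right (by simpa using hΓ) ENNReal.ofReal_ne_top]

end StableLaw

/-! ### Uniqueness for the Mellin transform. -/

section MellinUniqueness

/-- A measure on the positive half-line with finite moments of orders in `(-1, 0)` is determined
by them. -/
theorem Measure.ext_of_lintegral_rpow {α β : Measure ℝ} (hα : ∀ᵐ x ∂α, 0 < x)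
    (hβ : ∀ᵐ x ∂β, 0 < x)
    (hfin : ∀ p ∈ Ioo (0 : ℝ) 1, ∫⁻ x, ENNReal.ofReal (x ^ (-p)) ∂α ≠ ⊤)
    (h : ∀ p ∈ Ioo (0 : ℝ) 1, ∫⁻ x, ENNReal.ofReal (x ^ (-p)) ∂α
      = ∫⁻ x, ENNReal.ofReal (x ^ (-p)) ∂β) : α = β := by
  -- Tilting by `x^(-1/2)` makes the measure finite and centres the strip at `0`. The imaginary axis
  -- then lies inside it, and equal moments give equal characteristic functions of `-log x`.
  let w : ℝ → ENNReal := fun x => ENNReal.ofReal (x ^ (-(1 / 2 : ℝ)))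
  let X : ℝ → ℝ := fun x => -Real.log x
  have hw : Measurable w := by fun_prop
  have hX : Measurable X := by fun_prop
  have hlint : ∀ {γ : Measure ℝ}, (∀ᵐ x ∂γ, 0 < x) → ∀ s : ℝ,
      ∫⁻ x, ENNReal.ofReal (Real.exp (s * X x)) ∂(γ.withDensity w)
        = ∫⁻ x, ENNReal.ofReal (x ^ (-(1 / 2 + s))) ∂γ := by
    intro γ hγ s
    rw [lintegral_withDensity_eq_lintegral_mul _ hw (by fun_prop)]
    refine lintegral_congr_ae ?_
    filter_upwards [hγ] with x hx
    simp only [Pi.mul_apply, w, X]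
    rw [← ENNReal.ofReal_mul (Real.rpow_nonneg hx.le _), neg_add, Real.rpow_add hx,
      Real.rpow_def_of_pos hx (-s)]
    ring_nf
  have hmem : ∀ s ∈ Ioo (-(1 / 2) : ℝ) (1 / 2), 1 / 2 + s ∈ Ioo (0 : ℝ) 1 :=
    fun s hs => ⟨by linarith [hs.1], by linarith [hs.2]⟩
  have hset : ∀ {γ : Measure ℝ}, (∀ᵐ x ∂γ, 0 < x) →
      (∀ p ∈ Ioo (0 : ℝ) 1, ∫⁻ x, ENNReal.ofReal (x ^ (-p)) ∂γ ≠ ⊤) →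
      Ioo (-(1 / 2) : ℝ) (1 / 2) ⊆ integrableExpSet X (γ.withDensity w) := by
    intro γ hγ hf s hs
    refine (lintegral_ofReal_ne_top_iff_integrable (by fun_prop)
      (ae_of_all _ fun _ => (Real.exp_pos _).le)).1 ?_
    rw [hlint hγ]
    exact hf _ (hmem s hs)
  have hfinite : ∀ {γ : Measure ℝ},
      (∀ p ∈ Ioo (0 : ℝ) 1, ∫⁻ x, ENNReal.ofReal (x ^ (-p)) ∂γ ≠ ⊤) →
      IsFiniteMeasure (γ.withDensity w) := fun hf =>
    isFiniteMeasure_withDensity (hf (1 / 2) ⟨by norm_num, by norm_num⟩)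
  have hfin' : ∀ p ∈ Ioo (0 : ℝ) 1, ∫⁻ x, ENNReal.ofReal (x ^ (-p)) ∂β ≠ ⊤ :=
    fun p hp => h p hp ▸ hfin p hp
  have := hfinite hfin
  have := hfinite hfin'
  have hmgf : EqOn (complexMGF X (α.withDensity w)) (complexMGF X (β.withDensity w))
      {z | z.re ∈ Ioo (-(1 / 2) : ℝ) (1 / 2)} := by
    refine eqOn_strip_of_eqOn_real isOpen_Ioo (convex_Ioo _ _)
      (analyticOnNhd_complexMGF.mono fun z hz => interior_maximal (hset hα hfin) isOpen_Ioo hz)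
      (analyticOnNhd_complexMGF.mono fun z hz => interior_maximal (hset hβ hfin') isOpen_Ioo hz)
      fun s hs => ?_
    rw [complexMGF_ofReal, complexMGF_ofReal, mgf, mgf,
      integral_eq_lintegral_of_nonneg_ae (ae_of_all _ fun _ => (Real.exp_pos _).le)
        (by fun_prop),
      integral_eq_lintegral_of_nonneg_ae (ae_of_all _ fun _ => (Real.exp_pos _).le)
        (by fun_prop), hlint hα, hlint hβ, h _ (hmem s hs)]
  have hmap : (α.withDensity w).map X = (β.withDensity w).map X := by
    refine Measure.ext_of_charFun (funext fun s => ?_)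
    rw [← complexMGF_mul_I hX.aemeasurable, ← complexMGF_mul_I hX.aemeasurable]
    exact hmgf (by simp)
  have hback : ∀ {γ : Measure ℝ}, (∀ᵐ x ∂γ, 0 < x) →
      ((γ.withDensity w).map X).map (fun y => Real.exp (-y)) = γ.withDensity w := by
    intro γ hγ
    rw [Measure.map_map (by fun_prop) hX]
    calc _ = (γ.withDensity w).map id := by
          refine Measure.map_congr ?_
          filter_upwards [(withDensity_absolutelyContinuous γ w).ae_le hγ] with x hx
          simp [X, Real.exp_log hx]
      _ = _ := Measure.map_id
  have hinv : ∀ {γ : Measure ℝ}, (∀ᵐ x ∂γ, 0 < x) →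
      (γ.withDensity w).withDensity w⁻¹ = γ := by
    intro γ hγ
    refine withDensity_inv_same hw ?_ (ae_of_all _ fun _ => ENNReal.ofReal_ne_top)
    filter_upwards [hγ] with x hx
    simpa [w] using Real.rpow_pos_of_pos hx _
  rw [← hinv hα, ← hinv hβ, ← hback hα, ← hback hβ, hmap]

end MellinUniqueness

/-! ### Identification of the law with the Wright density. -/

section StableDensity

variable {n : ℕ} {t : ℝ} {μ : Measure ℝ}

/-- As the sign of the series is still unknown, its negative part is moved to the side of `μ`, so
that Mellin uniqueness applies to two positive measures. -/
theorem HasStableLaplace.add_withDensity_eq [IsFiniteMeasure μ] (hn : 2 ≤ n)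
    (h : HasStableLaplace (1 / n) t μ) (ht : 0 < t) :
    μ + (volume.restrict (Ioi 0)).withDensity
        (fun x => ENNReal.ofReal (-stableDensity (1 / n) x t))
      = (volume.restrict (Ioi 0)).withDensity
        (fun x => ENNReal.ofReal (stableDensity (1 / n) x t)) := by
  have hν : 0 < 1 / (n : ℝ) := by positivity
  have hmeas := measurable_stableDensity hn t
  have hpos := h.ae_pos hν ht
  have hwd : ∀ f : ℝ → ENNReal, ∀ᵐ x ∂(volume.restrict (Ioi 0)).withDensity f, (0 : ℝ) < x :=
    fun f => (withDensity_absolutelyContinuous _ f).ae_le (ae_restrict_mem measurableSet_Ioi)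
  have hlin : ∀ (p : ℝ) (f : ℝ → ℝ), Measurable f →
      ∫⁻ x, ENNReal.ofReal (x ^ (-p))
        ∂(volume.restrict (Ioi 0)).withDensity (fun x => ENNReal.ofReal (f x))
      = ∫⁻ x in Ioi (0 : ℝ), ENNReal.ofReal (x ^ (-p) * f x) := by
    intro p f hf
    rw [lintegral_withDensity_eq_lintegral_mul _ (by fun_prop) (by fun_prop)]
    refine setLIntegral_congr_fun measurableSet_Ioi fun x hx => ?_
    simp only [Pi.mul_apply]
    rw [mul_comm, ENNReal.ofReal_mul (Real.rpow_nonneg (le_of_lt hx) _)]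
  have key : ∀ p ∈ Ioo (0 : ℝ) 1,
      ∫⁻ x, ENNReal.ofReal (x ^ (-p)) ∂(μ + (volume.restrict (Ioi 0)).withDensity
        (fun x => ENNReal.ofReal (-stableDensity (1 / n) x t)))
      = ∫⁻ x, ENNReal.ofReal (x ^ (-p)) ∂((volume.restrict (Ioi 0)).withDensity
        (fun x => ENNReal.ofReal (stableDensity (1 / n) x t))) ∧
      ∫⁻ x, ENNReal.ofReal (x ^ (-p)) ∂((volume.restrict (Ioi 0)).withDensity
        (fun x => ENNReal.ofReal (stableDensity (1 / n) x t))) ≠ ⊤ := by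
    intro p hp
    have hi := integrableOn_rpow_mul_stableDensity hn hp.1 hp.2 ht
    have hM := integral_rpow_mul_stableDensity hn hp.1 hp.2 ht
    rw [integral_eq_lintegral_pos_part_sub_lintegral_neg_part hi] at hM
    have hA := hi.lintegral_lt_top
    have hB := hi.neg.lintegral_lt_top
    simp only [Pi.neg_apply] at hB
    rw [lintegral_add_measure, h.lintegral_rpow hν ht hp.1, hlin p _ hmeas, hlin p (fun x => -stableDensity (1 / n) x t) hmeas.neg]
    simp only [mul_neg]
    refine ⟨?_, hA.ne⟩
    have e : t ^ (-p / (1 / (n : ℝ))) * (1 / (1 / (n : ℝ))) * Real.Gamma (p / (1 / (n : ℝ)))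
        / Real.Gamma p = n * (t ^ (-(n * p)) * Real.Gamma (n * p)) / Real.Gamma p := by
      rw [show -p / (1 / (n : ℝ)) = -(n * p) by field_simp,
        show p / (1 / (n : ℝ)) = n * p by field_simp, one_div_one_div]
      ring
    have hnn : 0 ≤ n * (t ^ (-(n * p)) * Real.Gamma (n * p)) / Real.Gamma p := by
      have := Real.Gamma_pos_of_pos hp.1
      have : 0 < Real.Gamma (n * p) := Real.Gamma_pos_of_pos (by have := hp.1; positivity)
      positivity
    rw [e, ← ENNReal.ofReal_toReal hA.ne, ← ENNReal.ofReal_toReal hB.ne,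
      ← ENNReal.ofReal_add hnn ENNReal.toReal_nonneg, ← hM, sub_add_cancel]
  refine Measure.ext_of_lintegral_rpow ?_ (hwd _) (fun p hp => (key p hp).1 ▸ (key p hp).2)
    fun p hp => (key p hp).1
  rw [ae_add_measure_iff]
  exact ⟨hpos, hwd _⟩

/-- The positive part gives no mass to the set where the series is negative, hence neither does the
negative part. That set is therefore null, and being open by continuity it is empty. -/
theorem HasStableLaplace.stableDensity_nonneg [IsFiniteMeasure μ] (hn : 2 ≤ n)
    (h : HasStableLaplace (1 / n) t μ) (ht : 0 < t) {x : ℝ} (hx : 0 < x) :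
    0 ≤ stableDensity (1 / n) x t := by
  have hmeas := measurable_stableDensity hn t
  set S := Ioi (0 : ℝ) ∩ (fun x => stableDensity (1 / n) x t) ⁻¹' Iio 0 with hS
  have hcont : ContinuousOn (fun x => stableDensity (1 / n) x t) (Ioi 0) :=
    (continuousOn_stableDensity hn).comp
      (continuousOn_id.prodMk (continuousOn_const (c := t))) fun x hx => ⟨hx, mem_univ _⟩
  have hSo : IsOpen S := hcont.isOpen_inter_preimage isOpen_Ioi isOpen_Iio
  have h1 : (volume.restrict (Ioi 0)).withDensity
      (fun x => ENNReal.ofReal (stableDensity (1 / n) x t)) S = 0 := by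
    rw [withDensity_apply _ hSo.measurableSet, setLIntegral_congr_fun hSo.measurableSet
      (g := fun _ => 0) fun x hx => ENNReal.ofReal_of_nonpos (le_of_lt hx.2), lintegral_zero]
  rw [← h.add_withDensity_eq hn ht, Measure.add_apply, add_eq_zero,
    withDensity_apply _ hSo.measurableSet, lintegral_eq_zero_iff (by fun_prop),
    Measure.restrict_restrict hSo.measurableSet, inter_eq_left.2 inter_subset_left] at h1
  have h2 : volume S = 0 := by
    have h3 : ∀ᵐ x ∂(volume.restrict S), False := by
      filter_upwards [h1.2, ae_restrict_mem hSo.measurableSet] with x hx hxS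
      have : stableDensity (1 / n) x t < 0 := hxS.2
      simp only [Pi.zero_apply, ENNReal.ofReal_eq_zero] at hx
      linarith
    simpa [ae_iff] using h3
  by_contra hneg
  exact (hSo.measure_pos volume ⟨x, hx, not_le.1 hneg⟩).ne' h2

theorem HasStableLaplace.eq_withDensity [IsFiniteMeasure μ] (hn : 2 ≤ n)
    (h : HasStableLaplace (1 / n) t μ) (ht : 0 < t) :
    μ = (volume.restrict (Ioi 0)).withDensity
        (fun x => ENNReal.ofReal (stableDensity (1 / n) x t)) := by
  have h0 : (volume.restrict (Ioi 0)).withDensity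
      (fun x => ENNReal.ofReal (-stableDensity (1 / n) x t)) = 0 := by
    rw [withDensity_congr_ae (g := 0) ?_, withDensity_zero]
    filter_upwards [ae_restrict_mem measurableSet_Ioi] with x hx
    exact ENNReal.ofReal_of_nonpos (neg_nonpos.2 (h.stableDensity_nonneg hn ht hx))
  rw [← h.add_withDensity_eq hn ht, h0, add_zero]

end StableDensity

/-! ### Calculus with test functions on the quadrant. -/

section TestFunctions

/-- Test functions on the open quadrant `x > 0`, `t > 0`. -/
structure IsQuadrantTest (φ : ℝ × ℝ → ℝ) : Prop where
  contDiff : ContDiff ℝ ∞ φ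
  hasCompactSupport : HasCompactSupport φ
  tsupport_subset : tsupport φ ⊆ Ioi 0 ×ˢ Ioi 0

/-- The derivative of `φ` in the direction `v`. -/
noncomputable def dirDeriv (v : ℝ × ℝ) (φ : ℝ × ℝ → ℝ) : ℝ × ℝ → ℝ := fun p => fderiv ℝ φ p v

namespace IsQuadrantTest

variable {φ : ℝ × ℝ → ℝ}

theorem directional (hφ : IsQuadrantTest φ) (v : ℝ × ℝ) : IsQuadrantTest (dirDeriv v φ) where
  contDiff := (hφ.contDiff.fderiv_right (m := ∞) (by simp)).clm_apply contDiff_const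
  hasCompactSupport := hφ.hasCompactSupport.fderiv_apply ℝ v
  tsupport_subset := (tsupport_fderiv_apply_subset ℝ v).trans hφ.tsupport_subset

theorem iterate_dirDeriv (hφ : IsQuadrantTest φ) (v : ℝ × ℝ) (k : ℕ) :
    IsQuadrantTest ((dirDeriv v)^[k] φ) := by
  induction k with
  | zero => exact hφ
  | succ k ih => rw [Function.iterate_succ_apply']; exact ih.directional v

theorem apply_eq_zero (hφ : IsQuadrantTest φ) {p : ℝ × ℝ} (hp : p ∉ Ioi (0 : ℝ) ×ˢ Ioi (0 : ℝ)) :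
    φ p = 0 :=
  image_eq_zero_of_notMem_tsupport fun h => hp (hφ.tsupport_subset h)

/-- Lets factors singular at the edge of the quadrant, such as the density, be integrated over whole
lines and the whole plane. -/
theorem continuous_mul (hφ : IsQuadrantTest φ) {g : ℝ × ℝ → ℝ}
    (hg : ContinuousOn g (Ioi 0 ×ˢ Ioi 0)) : Continuous (φ * g) :=
  (hφ.contDiff.continuous.continuousOn.mul hg).continuous_of_tsupport_subset
    (isOpen_Ioi.prod isOpen_Ioi) ((tsupport_mul_subset_left).trans hφ.tsupport_subset)

theorem hasDerivAt_comp (hφ : IsQuadrantTest φ) {e : ℝ → ℝ × ℝ} {v : ℝ × ℝ} {s : ℝ}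
    (he : HasDerivAt e v s) : HasDerivAt (φ ∘ e) (dirDeriv v φ (e s)) s :=
  (hφ.contDiff.differentiable (by simp) (e s)).hasFDerivAt.comp_hasDerivAt s he

theorem integrable_mul_comp (hφ : IsQuadrantTest φ) {g : ℝ × ℝ → ℝ}
    (hg : ContinuousOn g (Ioi 0 ×ˢ Ioi 0)) {e : ℝ → ℝ × ℝ} (he : Topology.IsClosedEmbedding e) :
    Integrable (fun s => φ (e s) * g (e s)) :=
  ((hφ.continuous_mul hg).comp he.continuous).integrable_of_hasCompactSupport
    (hφ.hasCompactSupport.mul_right.comp_isClosedEmbedding he)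

/-- Integration by parts along a line. -/
theorem integral_mul_deriv_line (hφ : IsQuadrantTest φ) {g g' : ℝ × ℝ → ℝ}
    (hg : ContinuousOn g (Ioi 0 ×ˢ Ioi 0)) (hg' : ContinuousOn g' (Ioi 0 ×ˢ Ioi 0))
    {e : ℝ → ℝ × ℝ} {v : ℝ × ℝ} (he : Topology.IsClosedEmbedding e) (hev : ∀ s, HasDerivAt e v s)
    (hd : ∀ s, e s ∈ Ioi (0 : ℝ) ×ˢ Ioi (0 : ℝ) → HasDerivAt (g ∘ e) (g' (e s)) s) :
    ∫ s, φ (e s) * g' (e s) = -∫ s, dirDeriv v φ (e s) * g (e s) :=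
  integral_mul_deriv_eq_deriv_mul_of_integrable (u := φ ∘ e) (v := g ∘ e)
    (fun s _ => hφ.hasDerivAt_comp (hev s))
    (fun s hs => hd s (hφ.tsupport_subset (tsupport_comp_subset_preimage φ he.continuous hs)))
    (hφ.integrable_mul_comp hg' he) ((hφ.directional v).integrable_mul_comp hg he)
    (hφ.integrable_mul_comp hg he)

theorem integral_swap (hφ : IsQuadrantTest φ) {g : ℝ × ℝ → ℝ}
    (hg : ContinuousOn g (Ioi 0 ×ˢ Ioi 0)) :
    ∫ t, ∫ x, φ (x, t) * g (x, t) = ∫ x, ∫ t, φ (x, t) * g (x, t) :=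
  (integral_integral_swap_of_hasCompactSupport (f := fun x t => φ (x, t) * g (x, t))
    (hφ.continuous_mul hg) hφ.hasCompactSupport.mul_right).symm

end IsQuadrantTest

theorem isClosedEmbedding_vertical (x : ℝ) :
    Topology.IsClosedEmbedding (fun t : ℝ => (x, t)) :=
  Function.LeftInverse.isClosedEmbedding (f := Prod.snd) (fun _ => rfl) continuous_snd
    (by fun_prop)

theorem isClosedEmbedding_horizontal (t : ℝ) :
    Topology.IsClosedEmbedding (fun x : ℝ => (x, t)) :=
  Function.LeftInverse.isClosedEmbedding (f := Prod.fst) (fun _ => rfl) continuous_fst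
    (by fun_prop)

theorem isClosedEmbedding_diagonal : Topology.IsClosedEmbedding (fun t : ℝ => (t, t)) :=
  Function.LeftInverse.isClosedEmbedding (f := Prod.fst) (fun _ => rfl) continuous_fst
    (by fun_prop)

theorem hasDerivAt_vertical (x t : ℝ) : HasDerivAt (fun s : ℝ => (x, s)) (0, 1) t :=
  (hasDerivAt_const t x).prodMk (hasDerivAt_id t)

theorem hasDerivAt_horizontal (t x : ℝ) : HasDerivAt (fun y : ℝ => (y, t)) (1, 0) x :=
  (hasDerivAt_id x).prodMk (hasDerivAt_const x t)

theorem hasDerivAt_diagonal (t : ℝ) : HasDerivAt (fun s : ℝ => (s, s)) (1, 1) t :=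
  (hasDerivAt_id t).prodMk (hasDerivAt_id t)

theorem IsQuadrantTest.iteratedDeriv_time {φ : ℝ × ℝ → ℝ} (hφ : IsQuadrantTest φ) (k : ℕ)
    (x t : ℝ) : iteratedDeriv k (fun s => φ (x, s)) t = ((dirDeriv (0, 1))^[k] φ) (x, t) := by
  induction k generalizing t with
  | zero => simp
  | succ k ih =>
    rw [iteratedDeriv_succ, funext ih, Function.iterate_succ_apply']
    exact ((hφ.iterate_dirDeriv (0, 1) k).hasDerivAt_comp (hasDerivAt_vertical x t)).deriv

theorem IsQuadrantTest.iteratedDeriv_space {φ : ℝ × ℝ → ℝ} (hφ : IsQuadrantTest φ) (x t : ℝ) :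
    iteratedDeriv 1 (fun y => φ (y, t)) x = dirDeriv (1, 0) φ (x, t) := by
  rw [iteratedDeriv_one]
  exact (hφ.hasDerivAt_comp (hasDerivAt_horizontal t x)).deriv

end TestFunctions

/-! ### The equation in the sense of distributions. -/

section Distributional

/-- The integrand is `(∂_t + ∂_x) φ` at `(t, t)`, the derivative of `φ` along the diagonal, where
`φ` has compact support. -/
theorem solvesDistributionally_of_eq_dirac {μ : ℝ → Measure ℝ}
    (hμ : ∀ t, 0 < t → μ t = Measure.dirac t) : SolvesDistributionally 1 μ := by
  intro φ h1 h2 h3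
  have hφ : IsQuadrantTest φ := ⟨h1, h2, h3⟩
  have h := hφ.integral_mul_deriv_line (g := fun _ => 1) (g' := fun _ => 0) continuousOn_const
    continuousOn_const isClosedEmbedding_diagonal hasDerivAt_diagonal
    fun s _ => hasDerivAt_const s (1 : ℝ)
  simp only [mul_zero, integral_zero, mul_one] at h
  rw [eq_comm, neg_eq_zero] at h
  refine Eq.trans ?_ ((setIntegral_eq_integral_of_forall_compl_eq_zero (s := Ioi (0 : ℝ))
    fun t ht => (hφ.directional _).apply_eq_zero fun h => ht h.1).trans h)
  refine setIntegral_congr_fun measurableSet_Ioi fun t ht => ?_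
  simp only [hμ t ht, integral_dirac, hφ.iteratedDeriv_time, hφ.iteratedDeriv_space]
  rw [show ((1, 1) : ℝ × ℝ) = (0, 1) + (1, 0) by simp]
  simp only [Function.iterate_one, dirDeriv, map_add]

variable {n : ℕ}

theorem continuousOn_iteratedDeriv_stableDensity (hn : 2 ≤ n) (k : ℕ) :
    ContinuousOn (fun p : ℝ × ℝ => iteratedDeriv k (fun s => stableDensity (1 / n) p.1 s) p.2)
      (Ioi 0 ×ˢ Ioi 0) := by
  have hc := ((entireEgf_wrightCoeff_one_div hn).iterate_shift k).contDiff.continuous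
  simp only [iteratedDeriv_stableDensity hn]
  have hp : ContinuousOn (fun p : ℝ × ℝ => p.1 ^ (-(1 / n : ℝ))) (Ioi 0 ×ˢ Ioi 0) :=
    continuousOn_fst.rpow_const fun p hp => Or.inl (hp.1 : 0 < p.1).ne'
  have hi : ContinuousOn (fun p : ℝ × ℝ => p.1⁻¹) (Ioi 0 ×ˢ Ioi 0) :=
    continuousOn_fst.inv₀ fun p hp => (hp.1 : 0 < p.1).ne'
  exact hi.mul ((hp.pow k).mul (hc.comp_continuousOn (continuousOn_snd.mul hp)))

theorem IsQuadrantTest.integral_iterate_dirDeriv_mul_stableDensity (hn : 2 ≤ n) (k : ℕ)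
    {φ : ℝ × ℝ → ℝ} (hφ : IsQuadrantTest φ) (x : ℝ) :
    ∫ t, ((dirDeriv (0, 1))^[k] φ) (x, t) * stableDensity (1 / n) x t
      = (-1) ^ k * ∫ t, φ (x, t) * iteratedDeriv k (fun s => stableDensity (1 / n) x s) t := by
  induction k generalizing φ with
  | zero => simp
  | succ k ih =>
    rw [Function.iterate_succ_apply, ih (hφ.directional (0, 1)), pow_succ, mul_assoc,
      neg_one_mul]
    congr 1
    have h := hφ.integral_mul_deriv_line (continuousOn_iteratedDeriv_stableDensity hn k)
      (continuousOn_iteratedDeriv_stableDensity hn (k + 1)) (isClosedEmbedding_vertical x)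
      (hasDerivAt_vertical x) fun t _ => by
        rw [iteratedDeriv_succ]
        exact ((contDiff_stableDensity hn x).differentiable_iteratedDeriv k
          (by exact_mod_cast WithTop.coe_lt_top _) t).hasDerivAt
    rw [h, neg_neg]

/-- One integration by parts, with the classical PDE trading the `x`-derivative of the density for
its `n`-th `t`-derivative; the result cancels the term from `n` integrations by parts in time. -/
theorem IsQuadrantTest.integral_dirDeriv_space_mul_stableDensity (hn : 2 ≤ n)
    {φ : ℝ × ℝ → ℝ} (hφ : IsQuadrantTest φ) (t : ℝ) :
    ∫ x, dirDeriv (1, 0) φ (x, t) * stableDensity (1 / n) x t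
      = -((-1) ^ n * ∫ x, φ (x, t) * iteratedDeriv n (fun s => stableDensity (1 / n) x s) t) := by
  have h := hφ.integral_mul_deriv_line (continuousOn_iteratedDeriv_stableDensity hn 0)
    ((continuousOn_iteratedDeriv_stableDensity hn n).const_mul ((-1) ^ n))
    (isClosedEmbedding_horizontal t) (hasDerivAt_horizontal t) fun x hx => by
      have hd := (hasDerivAt_stableDensity hn hx.1 t).differentiableAt.hasDerivAt
      have he := leftD_stableDensity hn hx.1 t
      rw [leftD, leftD, iteratedDeriv_one, pow_one, neg_one_mul, add_neg_eq_zero] at he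
      simp only at he
      simp only [iteratedDeriv_zero]
      rw [he]
      exact hd
  simp only [iteratedDeriv_zero] at h
  rw [← integral_const_mul, eq_comm, neg_eq_iff_eq_neg, ← h]
  exact integral_congr_ae (ae_of_all _ fun x => by ring)

theorem solvesDistributionally_of_eq_withDensity (hn : 2 ≤ n) {μ : ℝ → Measure ℝ}
    (hμ : ∀ t, 0 < t → μ t = (volume.restrict (Ioi 0)).withDensity
      (fun x => ENNReal.ofReal (stableDensity (1 / n) x t)))
    (hnn : ∀ x t : ℝ, 0 < x → 0 < t → 0 ≤ stableDensity (1 / n) x t) :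
    SolvesDistributionally n μ := by
  intro φ h1 h2 h3
  have hφ : IsQuadrantTest φ := ⟨h1, h2, h3⟩
  have hc := continuousOn_iteratedDeriv_stableDensity hn 0
  have hcn := continuousOn_iteratedDeriv_stableDensity hn n
  simp only [iteratedDeriv_zero] at hc
  have hT := hφ.iterate_dirDeriv (0, 1) n
  have hX := hφ.directional (1, 0)
  have hinner : ∀ t ∈ Ioi (0 : ℝ), ∫ x, (iteratedDeriv n (fun s => φ (x, s)) t
      + iteratedDeriv 1 (fun y => φ (y, t)) x) ∂(μ t)
      = (∫ x, ((dirDeriv (0, 1))^[n] φ) (x, t) * stableDensity (1 / n) x t)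
        + ∫ x, dirDeriv (1, 0) φ (x, t) * stableDensity (1 / n) x t := by
    intro t ht
    have hmeas := measurable_stableDensity hn t
    simp only [hφ.iteratedDeriv_time, hφ.iteratedDeriv_space]
    rw [hμ t ht, integral_withDensity_eq_integral_toReal_smul (by fun_prop)
      (ae_of_all _ fun _ => ENNReal.ofReal_lt_top),
      ← integral_add (hT.integrable_mul_comp hc (isClosedEmbedding_horizontal t))
        (hX.integrable_mul_comp hc (isClosedEmbedding_horizontal t))]
    refine Eq.trans ?_ (setIntegral_eq_integral_of_forall_compl_eq_zero (s := Ioi (0 : ℝ))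
      fun x hx => by
        rw [hT.apply_eq_zero fun h => hx h.1, hX.apply_eq_zero fun h => hx h.1]; simp)
    refine setIntegral_congr_fun measurableSet_Ioi fun x hx => ?_
    simp only [ENNReal.toReal_ofReal (hnn x t hx ht), smul_eq_mul]
    ring
  rw [setIntegral_congr_fun measurableSet_Ioi hinner,
    setIntegral_eq_integral_of_forall_compl_eq_zero (fun t ht => by
      rw [integral_eq_zero_of_ae (ae_of_all _ fun x => ?_),
        integral_eq_zero_of_ae (ae_of_all _ fun x => ?_), add_zero]
      · simp [hX.apply_eq_zero fun h : (x, t) ∈ Ioi (0 : ℝ) ×ˢ Ioi (0 : ℝ) => ht h.2]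
      · simp [hT.apply_eq_zero fun h : (x, t) ∈ Ioi (0 : ℝ) ×ˢ Ioi (0 : ℝ) => ht h.2])]
  have hint : ∀ {ψ : ℝ × ℝ → ℝ}, IsQuadrantTest ψ →
      Integrable fun t => ∫ x, ψ (x, t) * stableDensity (1 / n) x t := fun hψ =>
    ((hψ.continuous_mul hc).integrable_of_hasCompactSupport
      hψ.hasCompactSupport.mul_right).integral_prod_right
  rw [integral_add (hint hT) (hint hX), hT.integral_swap hc]
  simp only [hφ.integral_iterate_dirDeriv_mul_stableDensity hn n,
    hφ.integral_dirDeriv_space_mul_stableDensity hn]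
  rw [integral_const_mul, integral_neg, integral_const_mul, hφ.integral_swap hcn, add_neg_cancel]

end Distributional

/-! ### From the process to its one-dimensional laws. -/

section Subordinator

variable {Ω : Type*} [MeasurableSpace Ω] {P : Measure Ω} {ν : ℝ} {H : ℝ≥0 → Ω → ℝ}

theorem IsStableSubordinator.hasStableLaplace (hH : IsStableSubordinator ν H P) (t : ℝ≥0) :
    HasStableLaplace ν t (P.map (H t)) := fun l hl => by
  rw [integral_map (hH.measurable t).aemeasurable (by fun_prop)]
  exact hH.laplace t l hl

/-- Right-continuity of almost every path at `0`, with dominated convergence under the sup norm of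
`f`. -/
theorem IsStableSubordinator.tendsto_integral [IsProbabilityMeasure P]
    (hH : IsStableSubordinator ν H P) (f : ℝ →ᵇ ℝ) :
    Tendsto (fun t : ℝ≥0 => ∫ x, f x ∂(P.map (H t))) (𝓝[>] 0) (𝓝 (f 0)) := by
  have h : Tendsto (fun t : ℝ≥0 => ∫ w, f (H t w) ∂P) (𝓝[>] 0) (𝓝 (∫ _, f 0 ∂P)) := by
    refine tendsto_integral_filter_of_dominated_convergence (fun _ => ‖f‖)
      (Eventually.of_forall fun t =>
        (f.continuous.measurable.comp (hH.measurable t)).aestronglyMeasurable)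
      (Eventually.of_forall fun t => ae_of_all _ fun w => f.norm_coe_le_norm _)
      (integrable_const _) ?_
    filter_upwards [hH.start, hH.paths] with w h0 hw
    have hc := (hw.2 0).tendsto.mono_left (nhdsWithin_mono 0 Ioi_subset_Ici_self)
    rw [h0] at hc
    exact (f.continuous.tendsto 0).comp hc
  rw [integral_const, probReal_univ, one_smul] at h
  refine h.congr fun t => ?_
  rw [integral_map (hH.measurable t).aemeasurable f.continuous.aestronglyMeasurable]

end Subordinator

theorem mainTheorem4 {Ω : Type*} [MeasurableSpace Ω] (P : Measure Ω) [IsProbabilityMeasure P]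
    (n : ℕ) (hn : 1 ≤ n) (H : ℝ≥0 → Ω → ℝ) (hH : IsStableSubordinator (1 / (n : ℝ)) H P) :
    -- the laws of `H t`, for every `n ≥ 1` (for `n = 1` they have no density)
    SolvesDistributionally n (fun t => P.map (H t.toNNReal)) ∧
    (∀ f : ℝ →ᵇ ℝ, Tendsto (fun t : ℝ≥0 => ∫ x, f x ∂(P.map (H t))) (𝓝[>] 0) (𝓝 (f 0))) ∧
    (∀ t : ℝ≥0, 0 < t →
      Tendsto (fun ε : ℝ => (P.map (H t)).real (Iic ε) / ε) (𝓝[>] 0) (𝓝 0)) ∧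
    -- for `n ≥ 2`, the density `h x t` of `H t`
    (2 ≤ n → ∃ h : ℝ → ℝ → ℝ,
      (∀ x t : ℝ, 0 < x → 0 < t → 0 ≤ h x t) ∧
      (∀ t : ℝ≥0, 0 < t →
        P.map (H t) = (volume.restrict (Ioi 0)).withDensity (fun x => ENNReal.ofReal (h x t))) ∧
      (∀ x : ℝ, 0 < x → ContDiffOn ℝ n (fun t => h x t) (Ioi 0)) ∧
      (∀ t : ℝ, 0 < t → DifferentiableOn ℝ (fun x => h x t) (Ioi 0)) ∧
      (∀ x t : ℝ, 0 < x → 0 < t →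
        leftD n (fun s => h x s) t + leftD 1 (fun y => h y t) x = 0) ∧
      (∀ x : ℝ, 0 < x → Tendsto (fun t => h x t) (𝓝[>] 0) (𝓝 0)) ∧
      (∀ t : ℝ, 0 < t → Tendsto (fun x => h x t) (𝓝[>] 0) (𝓝 0)) ∧
      (∀ k : ℕ, 0 < k → k < n → ∀ x : ℝ, 0 < x →
        Tendsto (fun t => leftD k (fun s => h x s) t) (𝓝[>] 0)
          (𝓝 (Phi ((k : ℝ) / n + 1) x)))) := by
  have hprob : ∀ t, IsProbabilityMeasure (P.map (H t)) :=
    fun t => Measure.isProbabilityMeasure_map (hH.measurable t).aemeasurable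
  have hlap : ∀ t : ℝ, 0 < t → HasStableLaplace (1 / n) t (P.map (H t.toNNReal)) := fun t ht => by
    simpa only [Real.coe_toNNReal t ht.le] using hH.hasStableLaplace t.toNNReal
  have hnn : 2 ≤ n → ∀ x t : ℝ, 0 < x → 0 < t → 0 ≤ stableDensity (1 / n) x t :=
    fun hn2 x t hx ht => (hlap t ht).stableDensity_nonneg hn2 ht hx
  refine ⟨?_, hH.tendsto_integral, fun t ht =>
    (hH.hasStableLaplace t).tendsto_measureReal_Iic_div (by positivity) ht, fun hn2 =>
    ⟨fun x t => stableDensity (1 / n) x t, hnn hn2,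
      fun t ht => (hH.hasStableLaplace t).eq_withDensity hn2 ht,
      fun x _ => ((contDiff_stableDensity hn2 x).of_le
        (by exact_mod_cast le_top)).contDiffOn,
      fun t _ x hx => (hasDerivAt_stableDensity hn2 hx t).differentiableAt.differentiableWithinAt,
      fun x t hx _ => leftD_stableDensity hn2 hx t,
      fun x _ => tendsto_stableDensity_time_zero hn2 x,
      fun t ht => tendsto_stableDensity_space_zero hn2 ht,
      fun k _ _ x hx => tendsto_leftD_stableDensity hn2 k hx⟩⟩
  -- For `n = 1` the process is the pure drift `H t = t` almost surely for each `t`, so the density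
  -- argument is unavailable.
  rcases hn.eq_or_lt with rfl | hn2
  · refine solvesDistributionally_of_eq_dirac fun t ht => ?_
    have h := hlap t ht
    rw [Nat.cast_one, div_one] at h
    exact h.eq_dirac
  · exact solvesDistributionally_of_eq_withDensity hn2
      (fun t ht => (hlap t ht).eq_withDensity hn2 ht) (hnn hn2)
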